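/- Let $\mathcal K$ be a finite dimensional and $\mathfrak h$ an arbitrary complex Hilbert space, $\beta>0$, $K$ a self-adjoint operator on $\mathcal K$, $Y$ a (possibly unbounded) self-adjoint operator on $\mathfrak h$, and $\nu\in B(\mathcal K,\mathcal K\otimes\mathfrak h)$ with $$\nu K=(K\otimes 1+1\otimes Y)\nu .$$ On $\mathcal Z=\mathcal K\otimes\Gamma_{\rm s}(\mathfrak h\otimes L^2(\mathbb R))$, where $\Gamma_{\rm s}$ is the bosonic Fock space with vacuum $\Omega$, let $E=K\otimes1+1\otimes d\Gamma(Y\otimes1)$, $\sigma_z(C)=e^{izE}Ce^{-izE}$ for $z\in\mathbb C$, and $$\omega_\beta(C)=\frac{\mathrm{Tr}\big(e^{-\beta K}\otimes|\Omega)(\Omega|\;C\big)}{\mathrm{Tr}\,e^{-\beta K}} .$$ For $V\in B(\mathcal K,\mathcal K\otimes\mathfrak h\otimes L^2(\mathbb R))$ let $a(V)$ be the annihilation operator, equal to $\sqrt n\,V^*\otimes1^{\otimes(n-1)}$ from the $n$-particle to the $(n-1)$-particle sector, and $a^*(V)=a(V)^*$. For $f_1,f_2\in L^2(\mathbb R)$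 consider the condition $(\mathrm{KMS}_{f_1,f_2})$: for all $D_1,D_2,D_1',D_2'\in B(\mathcal K)$ and all $t\in\mathbb R$, the operators $B_j=(D_j\otimes1)\big(a^*(\nu\otimes|f_j))+a(\nu\otimes|f_j))\big)(D_j'\otimes1)$, $j=1,2$, satisfy $$\omega_\beta(\sigma_t(B_1)B_2)=\omega_\beta(B_2\,\sigma_{t+i\beta}(B_1)),$$ both sides being well defined. Then the following are equivalent: 1. $(\mathrm{KMS}_{f_1,f_2})$ holds for all real-valued $f_1,f_2\in L^2(\mathbb R)$; 1'. $(\mathrm{KMS}_{f_1,f_2})$ holds for all complex $f_1,f_2\in L^2(\mathbb R)$ with $(f_1|f_2)\in\mathbb R$; 2. $\mathrm{Tr}_{\mathfrak h}\,\nu A\nu^*=\nu^*(A\otimes e^{-\beta Y})\nu$ for all $A\in B(\mathcal K)$. Moreover, if 2 holds, then for every $\Upsilon\in B(\mathcal K)$ with $-i\Upsilon+i\Upsilon^*=-\nu^*\nu$ and $[\tfrac12(\Upsilon+\Upsilon^*),K]=0$, the generator $M(A)=-i(\Upsilon A-A\Upsilon^*)+\nu^*(A\otimes1)\nu$ satisfies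 the detailed balance condition for $\rho=e^{-\beta K}/\mathrm{Tr}\,e^{-\beta K}$: in the decomposition $M=i[\Theta,\cdot]+M_{\rm d}$ into its Hamiltonian part ($\Theta=\Theta^*$) and its purely dissipative part ($M_{\rm d}(A)=-(\Delta A+A\Delta)+\sum_jL_j^*AL_j$ with finitely many $L_j$, $\mathrm{Tr}\,L_j=0$, and $\Delta=\Delta^*$), $M_{\rm d}$ is self-adjoint and $i[\Theta,\cdot]$ is anti-self-adjoint for the inner product $(A|B)_\rho=\mathrm{Tr}\,\rho^{1/2}A^*\rho^{1/2}B$ on $B(\mathcal K)$. -/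

import Mathlib

open scoped TensorProduct InnerProductSpace

noncomputable section

namespace QuantumNoise

/-! ### Hilbert space tensor products -/

section Tensor

variable {H₁ H₂ H₁' H₂' : Type*}
  [NormedAddCommGroup H₁] [InnerProductSpace ℂ H₁] [NormedAddCommGroup H₂] [InnerProductSpace ℂ H₂]
  [NormedAddCommGroup H₁'] [InnerProductSpace ℂ H₁']
  [NormedAddCommGroup H₂'] [InnerProductSpace ℂ H₂']

/-- The Hilbert space tensor product: the completion of the algebraic tensor product with its
canonical inner product `⟪x ⊗ y, x' ⊗ y'⟫ = ⟪x, x'⟫ ⟪y, y'⟫`. -/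
abbrev HTensor (H₁ H₂ : Type*) [NormedAddCommGroup H₁] [InnerProductSpace ℂ H₁]
    [NormedAddCommGroup H₂] [InnerProductSpace ℂ H₂] : Type _ :=
  UniformSpace.Completion (H₁ ⊗[ℂ] H₂)

/-- The elementary tensor `x ⊗ y` in the Hilbert space tensor product. -/
def tmulH (x : H₁) (y : H₂) : HTensor H₁ H₂ :=
  UniformSpace.Completion.toComplL (𝕜 := ℂ) (x ⊗ₜ[ℂ] y)

/-- The operator `1 ⊗ |y) : x ↦ x ⊗ y`. -/
def tensorKet (H₁ : Type*) [NormedAddCommGroup H₁] [InnerProductSpace ℂ H₁] (y : H₂) :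
    H₁ →L[ℂ] HTensor H₁ H₂ :=
  UniformSpace.Completion.toComplL ∘L (TensorProduct.mkL ℂ H₁ H₂).flip y

theorem norm_sq_sum_tmul {ι : Type*} [Fintype ι] (b : ι → H₁) (f : ι → H₂)
    (hf : Orthonormal ℂ f) : ‖∑ i, b i ⊗ₜ[ℂ] f i‖ ^ 2 = ∑ i, ‖b i‖ ^ 2 := by
  classical
  have h1 : ⟪∑ i, b i ⊗ₜ[ℂ] f i, ∑ i, b i ⊗ₜ[ℂ] f i⟫_ℂ = ((∑ i, ‖b i‖ ^ 2 : ℝ) : ℂ) := by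
    simp only [sum_inner, inner_sum, TensorProduct.inner_tmul, orthonormal_iff_ite.mp hf]
    simp [inner_self_eq_norm_sq_to_K]
  have h0 := (inner_self_eq_norm_sq_to_K (𝕜 := ℂ) (∑ i, b i ⊗ₜ[ℂ] f i)).symm.trans h1
  refine Complex.ofReal_injective (Eq.trans ?_ h0)
  simp

theorem norm_map_id_le (A : H₁ →L[ℂ] H₁') (x : H₁ ⊗[ℂ] H₂) :
    ‖TensorProduct.map (A : H₁ →ₗ[ℂ] H₁') (LinearMap.id : H₂ →ₗ[ℂ] H₂) x‖ ≤ ‖A‖ * ‖x‖ := by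
  obtain ⟨E', F', iE', iF', hz⟩ :=
    TensorProduct.exists_finite_submodule_of_setFinite {x} (Set.finite_singleton x)
  obtain ⟨y, hy⟩ := Set.singleton_subset_iff.mp hz
  let f := stdOrthonormalBasis ℂ F'
  have key : ∀ y : E' ⊗[ℂ] F', ∃ a : Fin (Module.finrank ℂ F') → H₁,
      TensorProduct.mapIncl E' F' y = ∑ i, a i ⊗ₜ[ℂ] (f i : H₂) := by
    intro y
    induction y using TensorProduct.induction_on with
    | zero => exact ⟨0, by simp⟩
    | tmul u v =>
      refine ⟨fun i => f.repr v i • (u : H₁), ?_⟩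
      have hv : (v : H₂) = ∑ i, f.repr v i • (f i : H₂) := by
        conv_lhs => rw [← f.sum_repr v]
        simp
      simp only [TensorProduct.mapIncl, TensorProduct.map_tmul, Submodule.subtype_apply]
      conv_lhs => rw [hv]
      simp [TensorProduct.tmul_sum, TensorProduct.smul_tmul]
    | add u v hu hv =>
      obtain ⟨a, ha⟩ := hu
      obtain ⟨b, hb⟩ := hv
      exact ⟨a + b, by simp [ha, hb, TensorProduct.add_tmul, Finset.sum_add_distrib]⟩
  obtain ⟨a, ha⟩ := key y
  rw [hy] at ha
  have hmap : TensorProduct.map (A : H₁ →ₗ[ℂ] H₁') (LinearMap.id : H₂ →ₗ[ℂ] H₂) x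
      = ∑ i, A (a i) ⊗ₜ[ℂ] (f i : H₂) := by
    rw [ha]; simp
  refine le_of_sq_le_sq ?_ (by positivity)
  have hf : Orthonormal ℂ (fun i => (f i : H₂)) :=
    f.orthonormal.comp_linearIsometry F'.subtypeₗᵢ
  rw [hmap, norm_sq_sum_tmul _ _ hf, mul_pow]
  conv_rhs => rw [ha]
  rw [norm_sq_sum_tmul _ _ hf, Finset.mul_sum]
  refine Finset.sum_le_sum fun i _ => ?_
  rw [← mul_pow]
  exact pow_le_pow_left₀ (norm_nonneg _) (A.le_opNorm _) 2

theorem norm_map_le (A : H₁ →L[ℂ] H₁') (B : H₂ →L[ℂ] H₂') (x : H₁ ⊗[ℂ] H₂) :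
    ‖TensorProduct.map (A : H₁ →ₗ[ℂ] H₁') (B : H₂ →ₗ[ℂ] H₂') x‖ ≤ ‖A‖ * ‖B‖ * ‖x‖ := by
  have h : TensorProduct.map (A : H₁ →ₗ[ℂ] H₁') (B : H₂ →ₗ[ℂ] H₂') x
      = TensorProduct.map (A : H₁ →ₗ[ℂ] H₁') (LinearMap.id : H₂' →ₗ[ℂ] H₂')
        (TensorProduct.comm ℂ H₂' H₁
          (TensorProduct.map (B : H₂ →ₗ[ℂ] H₂') (LinearMap.id : H₁ →ₗ[ℂ] H₁)
            (TensorProduct.comm ℂ H₁ H₂ x))) := by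
    induction x using TensorProduct.induction_on with
    | zero => simp
    | tmul u v => simp
    | add u v hu hv => simp only [map_add, hu, hv]
  rw [h, mul_assoc]
  refine (norm_map_id_le A _).trans ?_
  rw [TensorProduct.norm_comm]
  refine mul_le_mul_of_nonneg_left ?_ (norm_nonneg _)
  refine (norm_map_id_le B _).trans ?_
  rw [TensorProduct.norm_comm]

/-- The bounded operator `A ⊗ B` for bounded `A` and `B`. -/
def tensorB (A : H₁ →L[ℂ] H₁') (B : H₂ →L[ℂ] H₂') : HTensor H₁ H₂ →L[ℂ] HTensor H₁' H₂' :=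
  ((TensorProduct.map (A : H₁ →ₗ[ℂ] H₁') (B : H₂ →ₗ[ℂ] H₂')).mkContinuous (‖A‖ * ‖B‖)
    (norm_map_le A B)).completion

theorem tensorB_tmulH (A : H₁ →L[ℂ] H₁') (B : H₂ →L[ℂ] H₂') (x : H₁) (y : H₂) :
    tensorB A B (tmulH x y) = tmulH (A x) (B y) := by
  simp [tensorB, tmulH]

theorem tensorKet_apply (x : H₁) (y : H₂) : tensorKet H₁ y x = tmulH x y := rfl

end Tensor

/-! ### Unbounded operators

A possibly unbounded operator is a linear map `E →ₗ.[ℂ] F` defined on a subspace of `E`. -/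

section Unbounded

variable {E F G : Type*}
  [NormedAddCommGroup E] [InnerProductSpace ℂ E] [NormedAddCommGroup F] [InnerProductSpace ℂ F]
  [NormedAddCommGroup G] [InnerProductSpace ℂ G]

/-- A bounded operator as an operator with full domain. -/
def ofB (A : E →L[ℂ] F) : E →ₗ.[ℂ] F := (A : E →ₗ[ℂ] F).toPMap ⊤

/-- The product `g f` of two operators on its natural domain `{x ∈ Dom f | f x ∈ Dom g}`. -/
def opMul (g : F →ₗ.[ℂ] G) (f : E →ₗ.[ℂ] F) : E →ₗ.[ℂ] G where
  domain := (g.domain.comap f.toFun).map f.domain.subtype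
  toFun :=
    { toFun := fun x => g ⟨f ⟨x, by
          obtain ⟨y, -, hy⟩ := x.2; rw [← hy]; exact y.2⟩, by
          obtain ⟨x, y, hy, rfl⟩ := x; exact hy⟩
      map_add' := by
        rintro ⟨x, a, ha, rfl⟩ ⟨y, b, hb, rfl⟩
        rw [← g.map_add]
        congr 1
        ext
        exact f.map_add a b
      map_smul' := by
        rintro c ⟨x, a, ha, rfl⟩
        rw [RingHom.id_apply, ← g.map_smul]
        congr 1
        ext
        exact f.map_smul c a }

/-- The closed operator whose graph is the closure of the span of the given pairs
`(argument, value)`. -/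
def closedOp (S : Set (E × F)) : E →ₗ.[ℂ] F :=
  (Submodule.span ℂ S).topologicalClosure.toLinearPMap

/-- `A ⊗ B` for possibly unbounded `A`, `B`: the closure of the operator
`x ⊗ y ↦ A x ⊗ B y` on the algebraic tensor product of the domains. -/
def tensorOp {E' F' : Type*} [NormedAddCommGroup E'] [InnerProductSpace ℂ E']
    [NormedAddCommGroup F'] [InnerProductSpace ℂ F']
    (A : E →ₗ.[ℂ] F) (B : E' →ₗ.[ℂ] F') : HTensor E E' →ₗ.[ℂ] HTensor F F' :=
  closedOp {p | ∃ (x : A.domain) (y : B.domain), p = (tmulH (x : E) (y : E'), tmulH (A x) (B y))}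

/-- The exponential `e^{zA}`, `z ∈ ℂ`, of a self-adjoint operator `A`: the closure of the operator
`v ↦ ∑ n, zⁿ/n! Aⁿ v` on the entire analytic vectors of `A`, i.e. the vectors `v` in the domain of
all powers of `A` with `∑ n, rⁿ/n! ‖Aⁿ v‖ < ∞` for all `r`. For self-adjoint `A` these vectors
contain the ranges of all spectral projections `1_{[-c,c]}(A)` and so they are a core of the
operator `e^{zA}` of the functional calculus. -/
def expOp (z : ℂ) (A : E →ₗ.[ℂ] E) : E →ₗ.[ℂ] E :=
  closedOp {p | ∃ u : ℕ → E, (∀ n, (u n, u (n + 1)) ∈ A.graph) ∧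
    (∀ r : ℝ, Summable fun n => r ^ n / n.factorial * ‖u n‖) ∧
    p = (u 0, ∑' n, (z ^ n / n.factorial) • u n)}

end Unbounded

/-! ### The bosonic Fock space -/

section Fock

universe u

/-- A complex inner product space, bundled. -/
structure PreHilb where
  carrier : Type u
  [normed : NormedAddCommGroup carrier]
  [inner : InnerProductSpace ℂ carrier]

instance (X : PreHilb.{u}) : NormedAddCommGroup X.carrier := X.normed
instance (X : PreHilb.{u}) : InnerProductSpace ℂ X.carrier := X.inner

variable (H : Type u) [NormedAddCommGroup H] [InnerProductSpace ℂ H]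

/-- The algebraic tensor powers: `ℂ` for `n = 0` (as the Euclidean space of dimension one),
and `H ⊗ H^{⊗n}` for `n + 1`. -/
def tensorPow : ℕ → PreHilb.{u}
  | 0 => ⟨EuclideanSpace ℂ PUnit.{u + 1}⟩
  | n + 1 => ⟨H ⊗[ℂ] (tensorPow n).carrier⟩

variable {H}

/-- The elementary tensor `v₀ ⊗ ⋯ ⊗ vₙ₋₁`; the empty one is `1 ∈ ℂ`. -/
def elemTensor : (n : ℕ) → (Fin n → H) → (tensorPow H n).carrier
  | 0, _ => (EuclideanSpace.single PUnit.unit (1 : ℂ) : EuclideanSpace ℂ PUnit.{u + 1})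
  | n + 1, v => (v 0 ⊗ₜ[ℂ] elemTensor n (Fin.tail v) : H ⊗[ℂ] (tensorPow H n).carrier)

/-- The symmetrized elementary tensor `(1/n!) ∑_σ v_{σ 0} ⊗ ⋯ ⊗ v_{σ (n-1)}`. -/
def symTensor (n : ℕ) (v : Fin n → H) : UniformSpace.Completion (tensorPow H n).carrier :=
  UniformSpace.Completion.toComplL (𝕜 := ℂ)
    ((n.factorial : ℂ)⁻¹ • ∑ σ : Equiv.Perm (Fin n), elemTensor n (v ∘ σ))

variable (H)

/-- The symmetric tensor power `⊗ₛⁿ H`, a closed subspace of the completed tensor power. -/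
def symPow (n : ℕ) : Submodule ℂ (UniformSpace.Completion (tensorPow H n).carrier) :=
  (Submodule.span ℂ (Set.range (symTensor (H := H) n))).topologicalClosure

instance (n : ℕ) : CompleteSpace (symPow H n) :=
  inferInstanceAs (CompleteSpace
    (Submodule.span ℂ (Set.range (symTensor (H := H) n))).topologicalClosure)

/-- The bosonic Fock space `Γₛ(H)`, the Hilbert space direct sum of the `⊗ₛⁿ H`. -/
abbrev Fock : Type u := lp (fun n => symPow H n) 2

variable {H}

/-- The symmetrized elementary tensor as a vector of the Fock space. -/
def symVec (n : ℕ) (v : Fin n → H) : Fock H :=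
  lp.single 2 n ⟨symTensor n v,
    Submodule.le_topologicalClosure _ (Submodule.subset_span ⟨v, rfl⟩)⟩

variable (H) in
/-- The vacuum vector `Ω = 1 ∈ ⊗ₛ⁰ H = ℂ`. -/
def vacuum : Fock H := symVec 0 Fin.elim0

/-- The second quantization `dΓ(h)`: the closure of the operator that acts on symmetric tensors of
vectors from `Dom h` as `h ⊗ 1 ⊗ ⋯ ⊗ 1 + ⋯ + 1 ⊗ ⋯ ⊗ 1 ⊗ h`. -/
def dGamma (h : H →ₗ.[ℂ] H) : Fock H →ₗ.[ℂ] Fock H :=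
  closedOp {p | ∃ (n : ℕ) (v : Fin n → h.domain),
    p = (symVec n (fun i => (v i : H)),
      ∑ i, symVec n (Function.update (fun j => (v j : H)) i (h (v i))))}

variable {𝒦 : Type*} [NormedAddCommGroup 𝒦] [InnerProductSpace ℂ 𝒦] [CompleteSpace 𝒦]

/-- The annihilation operator `a(V)` of `V ∈ B(𝒦, 𝒦 ⊗ H)`, a closed operator on `𝒦 ⊗ Γₛ(H)`. It is
`√n V* ⊗ 1^{⊗(n-1)}` from `𝒦 ⊗ ⊗ₛⁿ H` to `𝒦 ⊗ ⊗ₛⁿ⁻¹ H`: since the first tensor factor of the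
symmetrization of `v₀ ⊗ ⋯ ⊗ vₙ` is equally distributed over the `vᵢ`, it maps
`k ⊗ S(v₀ ⊗ ⋯ ⊗ vₙ)` to `√(n+1) (1/(n+1)) ∑ᵢ V*(k ⊗ vᵢ) ⊗ S(⨂_{j ≠ i} vⱼ)`,
and it annihilates `𝒦 ⊗ Ω`. -/
def annih (V : 𝒦 →L[ℂ] HTensor 𝒦 H) : HTensor 𝒦 (Fock H) →ₗ.[ℂ] HTensor 𝒦 (Fock H) :=
  closedOp ({p | ∃ k : 𝒦, p = (tmulH k (vacuum H), 0)} ∪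
    {p | ∃ (n : ℕ) (k : 𝒦) (v : Fin (n + 1) → H),
      p = (tmulH k (symVec (n + 1) v), (√((n : ℝ) + 1) : ℂ) • (((n : ℂ) + 1)⁻¹ •
        ∑ i, tmulH (V.adjoint (tmulH k (v i))) (symVec n (i.removeNth v))))})

/-- The creation operator `a*(V) = a(V)*`. -/
def creat (V : 𝒦 →L[ℂ] HTensor 𝒦 H) : HTensor 𝒦 (Fock H) →ₗ.[ℂ] HTensor 𝒦 (Fock H) :=
  (annih V).adjoint

end Fock

/-! ### Small system, noise and total energy -/

section Noise

open MeasureTheory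

/-- The Hilbert space `L²(ℝ)` of complex functions. -/
abbrev L2R : Type := Lp ℂ 2 (volume : Measure ℝ)

variable (𝒦 𝔥 : Type*) [NormedAddCommGroup 𝒦] [InnerProductSpace ℂ 𝒦] [CompleteSpace 𝒦]
  [NormedAddCommGroup 𝔥] [InnerProductSpace ℂ 𝔥] [CompleteSpace 𝔥]

/-- The space `𝒵 = 𝒦 ⊗ Γₛ(𝔥 ⊗ L²(ℝ))`. -/
abbrev NoiseSpace : Type _ := HTensor 𝒦 (Fock (HTensor 𝔥 L2R))

variable {𝒦 𝔥}

/-- `ν ⊗ |f) : 𝒦 → 𝒦 ⊗ 𝔥 ⊗ L²(ℝ)`. -/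
def nuKet (ν : 𝒦 →L[ℂ] HTensor 𝒦 𝔥) (f : L2R) : 𝒦 →L[ℂ] HTensor 𝒦 (HTensor 𝔥 L2R) :=
  tensorB (ContinuousLinearMap.id ℂ 𝒦) (tensorKet 𝔥 f) ∘L ν

/-- The noise field operator `B = (D ⊗ 1) (a*(ν ⊗ |f)) + a(ν ⊗ |f))) (D' ⊗ 1)`. -/
def noiseField (ν : 𝒦 →L[ℂ] HTensor 𝒦 𝔥) (f : L2R) (D D' : 𝒦 →L[ℂ] 𝒦) :
    NoiseSpace 𝒦 𝔥 →ₗ.[ℂ] NoiseSpace 𝒦 𝔥 :=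
  opMul (ofB (tensorB D (ContinuousLinearMap.id ℂ _)))
    (opMul (creat (nuKet ν f) + annih (nuKet ν f))
      (ofB (tensorB D' (ContinuousLinearMap.id ℂ _))))

/-- The total energy operator `E = K ⊗ 1 + 1 ⊗ dΓ(Y ⊗ 1)`. -/
def totalEnergy (K : 𝒦 →L[ℂ] 𝒦) (Y : 𝔥 →ₗ.[ℂ] 𝔥) :
    NoiseSpace 𝒦 𝔥 →ₗ.[ℂ] NoiseSpace 𝒦 𝔥 :=
  ofB (tensorB K (ContinuousLinearMap.id ℂ _)) +
    tensorOp (ofB (ContinuousLinearMap.id ℂ 𝒦))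
      (dGamma (tensorOp Y (ofB (ContinuousLinearMap.id ℂ L2R))))

/-- The dynamics `σ_z(C) = e^{izE} C e^{-izE}` at the (real or complex) time `z`. -/
def sigma {Z : Type*} [NormedAddCommGroup Z] [InnerProductSpace ℂ Z]
    (E : Z →ₗ.[ℂ] Z) (z : ℂ) (C : Z →ₗ.[ℂ] Z) : Z →ₗ.[ℂ] Z :=
  opMul (expOp (Complex.I * z) E) (opMul C (expOp (-(Complex.I * z)) E))

/-- The Gibbs operator `e^{-βK}` of the small system. -/
def gibbs (β : ℝ) (K : 𝒦 →L[ℂ] 𝒦) : 𝒦 →L[ℂ] 𝒦 := NormedSpace.exp (-(β : ℂ) • K)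

/-- The trace of an operator on the finite dimensional space `𝒦`. -/
def tr (A : 𝒦 →L[ℂ] 𝒦) : ℂ := LinearMap.trace ℂ 𝒦 (A : 𝒦 →ₗ[ℂ] 𝒦)

/-- The normalized Gibbs density matrix `e^{-βK} / Tr e^{-βK}`. -/
def gibbsState (β : ℝ) (K : 𝒦 →L[ℂ] 𝒦) : 𝒦 →L[ℂ] 𝒦 := (tr (gibbs β K))⁻¹ • gibbs β K

/-- `ω_β(C)` is defined and equals `c`, where
`ω_β(C) = Tr (e^{-βK} ⊗ |Ω)(Ω| C) / Tr e^{-βK} = Tr (e^{-βK} I* C I) / Tr e^{-βK}` with the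
embedding `I k = k ⊗ Ω`; for an unbounded `C` this asks that `𝒦 ⊗ Ω ⊆ Dom C`. -/
def HasExpectation (β : ℝ) (K : 𝒦 →L[ℂ] 𝒦) (C : NoiseSpace 𝒦 𝔥 →ₗ.[ℂ] NoiseSpace 𝒦 𝔥)
    (c : ℂ) : Prop :=
  ∃ T : 𝒦 →L[ℂ] 𝒦,
    ofB T = opMul (ofB (tensorKet 𝒦 (vacuum (HTensor 𝔥 L2R))).adjoint)
      (opMul C (ofB (tensorKet 𝒦 (vacuum (HTensor 𝔥 L2R))))) ∧
    c = tr (gibbs β K * T) / tr (gibbs β K)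

/-- The `β`-KMS condition `ω_β(σ_t(B₁) B₂) = ω_β(B₂ σ_{t+iβ}(B₁))`, `t ∈ ℝ`, both sides being
defined, for the noise field operators `B₁`, `B₂` with the test functions `f₁`, `f₂`. -/
def KMS (β : ℝ) (K : 𝒦 →L[ℂ] 𝒦) (Y : 𝔥 →ₗ.[ℂ] 𝔥) (ν : 𝒦 →L[ℂ] HTensor 𝒦 𝔥)
    (f₁ f₂ : L2R) : Prop :=
  ∀ (D₁ D₁' D₂ D₂' : 𝒦 →L[ℂ] 𝒦) (t : ℝ), ∃ c : ℂ,
    HasExpectation β K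
      (opMul (sigma (totalEnergy K Y) t (noiseField ν f₁ D₁ D₁')) (noiseField ν f₂ D₂ D₂')) c ∧
    HasExpectation β K
      (opMul (noiseField ν f₂ D₂ D₂')
        (sigma (totalEnergy K Y) (t + Complex.I * β) (noiseField ν f₁ D₁ D₁'))) c

/-- The index set of a Hilbert basis of `𝔥`. -/
def basisIndex (𝔥 : Type*) [NormedAddCommGroup 𝔥] [InnerProductSpace ℂ 𝔥] [CompleteSpace 𝔥] :
    Set 𝔥 :=
  (exists_hilbertBasis ℂ 𝔥).choose

/-- A Hilbert basis of `𝔥`. -/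
def basisOf (𝔥 : Type*) [NormedAddCommGroup 𝔥] [InnerProductSpace ℂ 𝔥] [CompleteSpace 𝔥] :
    HilbertBasis (basisIndex 𝔥) ℂ 𝔥 :=
  (exists_hilbertBasis ℂ 𝔥).choose_spec.choose

/-- The partial trace `Tr_𝔥 C = ∑ⱼ (1 ⊗ (bⱼ|) C (1 ⊗ |bⱼ))` over a Hilbert basis of `𝔥`, for a
trace class `C` on `𝒦 ⊗ 𝔥` with `𝒦` finite dimensional (for which the sum converges absolutely
and does not depend on the basis). -/
def partialTrace (C : HTensor 𝒦 𝔥 →L[ℂ] HTensor 𝒦 𝔥) : 𝒦 →L[ℂ] 𝒦 :=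
  ∑' j, (tensorKet 𝒦 (basisOf 𝔥 j)).adjoint ∘L C ∘L tensorKet 𝒦 (basisOf 𝔥 j)

/-- `ν K = (K ⊗ 1 + 1 ⊗ Y) ν`, as an identity of operators (so that `Ran ν` is contained in the
domain of `K ⊗ 1 + 1 ⊗ Y`). -/
def Intertwines (K : 𝒦 →L[ℂ] 𝒦) (Y : 𝔥 →ₗ.[ℂ] 𝔥) (ν : 𝒦 →L[ℂ] HTensor 𝒦 𝔥) : Prop :=
  ofB (ν ∘L K) = opMul (ofB (tensorB K (ContinuousLinearMap.id ℂ 𝔥)) +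
    tensorOp (ofB (ContinuousLinearMap.id ℂ 𝒦)) Y) (ofB ν)

/-- `Tr_𝔥 ν A ν* = ν* (A ⊗ e^{-βY}) ν` for all `A ∈ B(𝒦)`, as an identity of operators. -/
def TraceCondition (β : ℝ) (Y : 𝔥 →ₗ.[ℂ] 𝔥) (ν : 𝒦 →L[ℂ] HTensor 𝒦 𝔥) : Prop :=
  ∀ A : 𝒦 →L[ℂ] 𝒦,
    ofB (partialTrace (ν ∘L A ∘L ν.adjoint)) =
      opMul (ofB ν.adjoint) (opMul (tensorOp (ofB A) (expOp (-(β : ℂ)) Y)) (ofB ν))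

end Noise

/-! ### Detailed balance -/

section DetailedBalance

variable {𝒦 𝔥 : Type*} [NormedAddCommGroup 𝒦] [InnerProductSpace ℂ 𝒦] [CompleteSpace 𝒦]
  [NormedAddCommGroup 𝔥] [InnerProductSpace ℂ 𝔥]

/-- The Lindblad generator `M(A) = -i (Υ A - A Υ*) + ν* (A ⊗ 1) ν`. -/
def lindblad (Υ : 𝒦 →L[ℂ] 𝒦) (ν : 𝒦 →L[ℂ] HTensor 𝒦 𝔥) (A : 𝒦 →L[ℂ] 𝒦) : 𝒦 →L[ℂ] 𝒦 :=
  -Complex.I • (Υ * A - A * star Υ) +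
    ν.adjoint ∘L tensorB A (ContinuousLinearMap.id ℂ 𝔥) ∘L ν

/-- A generator of a completely positive semigroup is purely dissipative if, in its normalized
Lindblad form `i[Θ, A] - (Δ A + A Δ) + ∑ⱼ Lⱼ* A Lⱼ` with `Tr Θ = 0`, `Tr Lⱼ = 0`, the Hamiltonian
part `Θ` vanishes. -/
def PurelyDissipative (M : (𝒦 →L[ℂ] 𝒦) → (𝒦 →L[ℂ] 𝒦)) : Prop :=
  ∃ (n : ℕ) (Δ : 𝒦 →L[ℂ] 𝒦) (L : Fin n → 𝒦 →L[ℂ] 𝒦),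
    IsSelfAdjoint Δ ∧ (∀ j, tr (L j) = 0) ∧
    ∀ A, M A = -(Δ * A + A * Δ) + ∑ j, star (L j) * A * L j

/-- The inner product `(A|B)_ρ = Tr ρ^{1/2} A* ρ^{1/2} B`. -/
def rhoInner (ρ A B : 𝒦 →L[ℂ] 𝒦) : ℂ := tr (CFC.sqrt ρ * star A * CFC.sqrt ρ * B)

/-- The detailed balance condition of a generator `M` for the density matrix `ρ`: in the
decomposition `M = i[Θ, ·] + M_d` into the Hamiltonian and the purely dissipative part, `M_d` is
self-adjoint and `i[Θ, ·]` is anti-self-adjoint for `(·|·)_ρ`. -/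
def DetailedBalance (M : (𝒦 →L[ℂ] 𝒦) → (𝒦 →L[ℂ] 𝒦)) (ρ : 𝒦 →L[ℂ] 𝒦) : Prop :=
  ∃ (Θ : 𝒦 →L[ℂ] 𝒦) (Md : (𝒦 →L[ℂ] 𝒦) → (𝒦 →L[ℂ] 𝒦)),
    IsSelfAdjoint Θ ∧ PurelyDissipative Md ∧
    (∀ A, M A = Complex.I • (Θ * A - A * Θ) + Md A) ∧
    (∀ A B, rhoInner ρ (Md A) B = rhoInner ρ A (Md B)) ∧
    (∀ A B, rhoInner ρ (Complex.I • (Θ * A - A * Θ)) B =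
      -rhoInner ρ A (Complex.I • (Θ * B - B * Θ)))

end DetailedBalance

end QuantumNoise

end

set_option linter.unusedSectionVars false

namespace QuantumNoise

/-! ### Elementary tensors and slices -/

section Elementary

variable {H₁ H₂ H₁' H₂' F : Type*}
  [NormedAddCommGroup H₁] [InnerProductSpace ℂ H₁] [NormedAddCommGroup H₂] [InnerProductSpace ℂ H₂]
  [NormedAddCommGroup H₁'] [InnerProductSpace ℂ H₁']
  [NormedAddCommGroup H₂'] [InnerProductSpace ℂ H₂']
  [NormedAddCommGroup F] [InnerProductSpace ℂ F]

/-! Everything reduces to a finite family of vectors of `𝔥`. In an orthonormal eigenbasis `e` of `K`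
with eigenvalues `κ`, write `ν eᵢ = ∑ⱼ eⱼ ⊗ h j i`. The intertwining relation makes each `h j i` an
eigenvector of `Y` for `κ i - κ j` (zero vectors allowed), so `e^{-βY}` acts on it by a scalar, and
`⟪h j i, h l m⟫ = 0` unless the two differences agree (`inner_h_eq_zero`).

Tested on rank one `A`, the trace condition becomes `⟪h q b, h p a⟫ = e^{-β(κ q - κ b)} ⟪h a p, h b
q⟫` (`Balanced`, `traceCondition_iff`). For KMS, one field operator takes `k ⊗ Ω` to a one-particle
vector. The other takes this to a vacuum part plus a two-particle part, which `ω_β` ignores. Hence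
both sides are finite sums, `⟪f₁, f₂⟫ corr(-it) P Q` and `⟪f₂, f₁⟫ corr(it - β) Q P`, with the same
`P`, `Q` (`kms_iff`). Balance makes the two sums agree term by term (`corr_comm`), and the
prefactors agree when `⟪f₁, f₂⟫` is real. Conversely, one nonzero `f₁ = f₂`, time zero and rank one
`P`, `Q` recover every balance relation (`balanced_of_kms`).

For detailed balance, `Υ = Θ - (i/2) ν*ν` splits `M` into `-i[Θ, ·]` and the rest. Both `Θ` and
`ν*ν` commute with `K`, so multiplication by them on either side is self-adjoint for `(·|·)_ρ`. The
map `A ↦ ν*(A ⊗ 1)ν` is self-adjoint by balance (`rhoInner_adjoint_tensorB`). Balance also ensures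
that making the `Lⱼ` traceless creates no Hamiltonian term (`purelyDissipative`).

The unbounded operators are closures of spans of generating pairs, and such a closure must be shown
to be a graph. `AdjPair` does this by pairing the generators with formal adjoints. All vectors
evolved are finite sums of eigenvectors, so neither the spectral theorem for `Y` nor
self-adjointness of the total energy is needed. -/

@[simp]
theorem inner_tmulH (x x' : H₁) (y y' : H₂) :
    ⟪tmulH x y, tmulH x' y'⟫_ℂ = ⟪x, x'⟫_ℂ * ⟪y, y'⟫_ℂ := by
  simp [tmulH, UniformSpace.Completion.inner_coe]

/-- The operator `|x) ⊗ 1 : y ↦ x ⊗ y`. -/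
noncomputable def leftKet (x : H₁) : H₂ →L[ℂ] HTensor H₁ H₂ :=
  UniformSpace.Completion.toComplL ∘L TensorProduct.mkL ℂ H₁ H₂ x

theorem leftKet_apply (x : H₁) (y : H₂) : leftKet x y = tmulH x y := rfl

theorem smul_tmulH (c : ℂ) (x : H₁) (y : H₂) : tmulH (c • x) y = c • tmulH x y :=
  map_smul (tensorKet H₁ y) c x

theorem sum_tmulH {ι : Type*} (s : Finset ι) (x : ι → H₁) (y : H₂) :
    tmulH (∑ i ∈ s, x i) y = ∑ i ∈ s, tmulH (x i) y :=
  map_sum (tensorKet H₁ y) x s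

theorem tmulH_smul (c : ℂ) (x : H₁) (y : H₂) : tmulH x (c • y) = c • tmulH x y :=
  map_smul (leftKet x) c y

theorem closure_span_tmulH :
    (Submodule.span ℂ {z : HTensor H₁ H₂ |
      ∃ (x : H₁) (y : H₂), z = tmulH x y}).topologicalClosure = ⊤ := by
  rw [← Submodule.dense_iff_topologicalClosure_eq_top]
  refine UniformSpace.Completion.denseRange_coe.mono ?_
  rintro _ ⟨z, rfl⟩
  induction z using TensorProduct.induction_on with
  | zero => exact (UniformSpace.Completion.coe_zero (α := H₁ ⊗[ℂ] H₂)) ▸ zero_mem _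
  | tmul x y => exact Submodule.subset_span ⟨x, y, rfl⟩
  | add u v hu hv =>
    rw [UniformSpace.Completion.coe_add]
    exact add_mem hu hv

theorem mem_of_forall_tmulH {C : Submodule ℂ (HTensor H₁ H₂)}
    (hC : IsClosed (C : Set (HTensor H₁ H₂))) (h : ∀ (x : H₁) (y : H₂), tmulH x y ∈ C)
    (z : HTensor H₁ H₂) :
    z ∈ C := by
  have hle := Submodule.topologicalClosure_minimal
    (Submodule.span ℂ {z : HTensor H₁ H₂ | ∃ (x : H₁) (y : H₂), z = tmulH x y})
    (Submodule.span_le.mpr (by rintro _ ⟨x, y, rfl⟩; exact h x y)) hC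
  rw [closure_span_tmulH] at hle
  exact hle Submodule.mem_top

theorem clm_ext_tmulH {f g : HTensor H₁ H₂ →L[ℂ] F}
    (h : ∀ x y, f (tmulH x y) = g (tmulH x y)) : f = g := by
  ext z
  have : IsClosed ((f - g).ker : Set (HTensor H₁ H₂)) := ContinuousLinearMap.isClosed_ker (f - g)
  have hz := mem_of_forall_tmulH (C := (f - g).ker) this
    (fun x y => by simp [h]) z
  simpa [sub_eq_zero] using hz

theorem tmulH_mem_closure_span {D₁ : Set H₁} {D₂ : Set H₂} {C : Submodule ℂ (HTensor H₁ H₂)}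
    (hC : IsClosed (C : Set (HTensor H₁ H₂))) (h : ∀ x ∈ D₁, ∀ y ∈ D₂, tmulH x y ∈ C)
    {x : H₁} (hx : x ∈ (Submodule.span ℂ D₁).topologicalClosure)
    {y : H₂} (hy : y ∈ (Submodule.span ℂ D₂).topologicalClosure) : tmulH x y ∈ C := by
  have h1 : ∀ x ∈ D₁, tmulH x y ∈ C := fun x hx =>
    Submodule.topologicalClosure_minimal 
      (t := C.comap (leftKet x : H₂ →L[ℂ] HTensor H₁ H₂).toLinearMap) _
      (Submodule.span_le.mpr fun y hy => h x hx y hy)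
      (hC.preimage (leftKet (H₂ := H₂) x).continuous) hy
  exact Submodule.topologicalClosure_minimal
      (t := C.comap (tensorKet H₁ y : H₁ →ₗ[ℂ] HTensor H₁ H₂)) _
      (Submodule.span_le.mpr fun x hx => h1 x hx) (hC.preimage (tensorKet H₁ y).continuous) hx

variable [CompleteSpace H₂]

/-- The operator `(x| ⊗ 1 : x' ⊗ y ↦ (x|x') y`. -/
noncomputable def slice (x : H₁) : HTensor H₁ H₂ →L[ℂ] H₂ := (leftKet x).adjoint

theorem inner_slice (x : H₁) (y : H₂) (z : HTensor H₁ H₂) :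
    ⟪y, slice x z⟫_ℂ = ⟪tmulH x y, z⟫_ℂ :=
  ContinuousLinearMap.adjoint_inner_right _ _ _

theorem slice_tmulH (x x' : H₁) (y : H₂) : slice x (tmulH x' y) = ⟪x, x'⟫_ℂ • y := by
  refine ext_inner_left ℂ fun v => ?_
  rw [inner_slice, inner_tmulH, inner_smul_right]

/-- The resolution of the identity `∑ |eⱼ)(eⱼ| ⊗ 1`. It lets a vector of `𝒦 ⊗ 𝔥` be handled as a
finite list of components in `𝔥`. -/
theorem sum_tmulH_slice {ι : Type*} [Fintype ι] (e : OrthonormalBasis ι ℂ H₁)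
    (z : HTensor H₁ H₂) : ∑ j, tmulH (e j) (slice (e j) z) = z := by
  have : (∑ j, leftKet (e j) ∘L slice (e j)) = ContinuousLinearMap.id ℂ (HTensor H₁ H₂) := by
    refine clm_ext_tmulH fun x y => ?_
    simp only [sum_apply, ContinuousLinearMap.comp_apply, slice_tmulH,
      leftKet_apply, tmulH_smul, ContinuousLinearMap.id_apply, ← smul_tmulH, ← sum_tmulH]
    rw [e.sum_repr' x]
  simpa [leftKet_apply] using congrArg (fun f => f z) this

end Elementary

/-! ### Graphs of operators -/

section Graphs

variable {E F G : Type*}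
  [NormedAddCommGroup E] [InnerProductSpace ℂ E] [NormedAddCommGroup F] [InnerProductSpace ℂ F]
  [NormedAddCommGroup G] [InnerProductSpace ℂ G]

theorem mem_graph_ofB {A : E →L[ℂ] F} {x : E} {y : F} : (x, y) ∈ (ofB A).graph ↔ A x = y := by
  simp only [LinearPMap.mem_graph_iff]
  constructor
  · rintro ⟨z, rfl, rfl⟩; rfl
  · rintro rfl; exact ⟨⟨x, trivial⟩, rfl, rfl⟩

theorem mem_graph_opMul {g : F →ₗ.[ℂ] G} {f : E →ₗ.[ℂ] F} {x : E} {z : G} :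
    (x, z) ∈ (opMul g f).graph ↔ ∃ y, (x, y) ∈ f.graph ∧ (y, z) ∈ g.graph := by
  simp only [LinearPMap.mem_graph_iff]
  constructor
  · rintro ⟨⟨_, a, ha, rfl⟩, rfl, rfl⟩
    exact ⟨f a, ⟨a, rfl, rfl⟩, ⟨⟨f a, ha⟩, rfl, rfl⟩⟩
  · rintro ⟨y, ⟨a, rfl, rfl⟩, ⟨b, hb, rfl⟩⟩
    have ha : f a ∈ g.domain := hb ▸ b.2
    refine ⟨⟨a, a, ha, rfl⟩, rfl, ?_⟩
    have : b = ⟨f a, ha⟩ := Subtype.ext hb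
    rw [this]
    rfl

theorem mem_graph_add {f g : E →ₗ.[ℂ] F} {x : E} {y : F} :
    (x, y) ∈ (f + g).graph ↔ ∃ a b, (x, a) ∈ f.graph ∧ (x, b) ∈ g.graph ∧ a + b = y := by
  simp only [LinearPMap.mem_graph_iff]
  constructor
  · rintro ⟨⟨z, hf, hg⟩, rfl, rfl⟩
    exact ⟨f ⟨z, hf⟩, g ⟨z, hg⟩, ⟨_, rfl, rfl⟩, ⟨_, rfl, rfl⟩, rfl⟩
  · rintro ⟨_, _, ⟨a, rfl, rfl⟩, ⟨b, hb, rfl⟩, rfl⟩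
    have ha : (a : E) ∈ g.domain := hb ▸ b.2
    refine ⟨⟨a, a.2, ha⟩, rfl, ?_⟩
    have : b = ⟨a, ha⟩ := Subtype.ext hb
    rw [this]
    rfl

/-- Since `ofB T` has full domain, inclusion of graphs already forces equality. Operator identities
that include a domain claim thus reduce to graph membership, and by `ofB_eq_iff_basis` to membership
for basis vectors. -/
theorem ofB_eq_iff {T : E →L[ℂ] F} {f : E →ₗ.[ℂ] F} :
    ofB T = f ↔ ∀ x, (x, T x) ∈ f.graph := by
  constructor
  · rintro rfl x
    exact mem_graph_ofB.mpr rfl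
  · intro h
    refine LinearPMap.eq_of_le_of_domain_eq (LinearPMap.le_of_le_graph ?_) ?_
    · rintro ⟨x, y⟩ hxy
      rw [← mem_graph_ofB.mp hxy]
      exact h x
    · exact (eq_top_iff.mpr fun x _ => LinearPMap.mem_domain_of_mem_graph (h x)).symm

/-- Formally adjoint sets of pairs `(argument, value)`, such that the values of the first are
approximated by the arguments of the second. -/
structure AdjPair (S : Set (E × F)) (S' : Set (F × E)) : Prop where
  inner_eq : ∀ p ∈ S, ∀ q ∈ S', ⟪p.2, q.1⟫_ℂ = ⟪p.1, q.2⟫_ℂ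
  range_le : ∀ p ∈ S, p.2 ∈ (Submodule.span ℂ (Prod.fst '' S')).topologicalClosure

theorem inner_eq_of_mem_closure_left {S : Set (E × F)} {q : F × E}
    (h : ∀ p ∈ S, ⟪p.2, q.1⟫_ℂ = ⟪p.1, q.2⟫_ℂ) {p : E × F}
    (hp : p ∈ (Submodule.span ℂ S).topologicalClosure) : ⟪p.2, q.1⟫_ℂ = ⟪p.1, q.2⟫_ℂ := by
  let C : Submodule ℂ (E × F) :=
    { carrier := {p | ⟪p.2, q.1⟫_ℂ = ⟪p.1, q.2⟫_ℂ}
      zero_mem' := by simp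
      add_mem' := by
        intro a b ha hb
        simp only [Set.mem_ofPred_eq, Prod.snd_add, Prod.fst_add, inner_add_left] at *
        rw [ha, hb]
      smul_mem' := by
        intro c a ha
        simp only [Set.mem_ofPred_eq, Prod.smul_snd, Prod.smul_fst, inner_smul_left] at *
        rw [ha] }
  have hC : IsClosed (C : Set (E × F)) := isClosed_eq (by fun_prop) (by fun_prop)
  exact Submodule.topologicalClosure_minimal (t := C) _ (Submodule.span_le.mpr h) hC hp

theorem inner_eq_of_mem_closure {S : Set (E × F)} {S' : Set (F × E)}
    (h : ∀ p ∈ S, ∀ q ∈ S', ⟪p.2, q.1⟫_ℂ = ⟪p.1, q.2⟫_ℂ) {p : E × F} {q : F × E}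
    (hp : p ∈ (Submodule.span ℂ S).topologicalClosure)
    (hq : q ∈ (Submodule.span ℂ S').topologicalClosure) : ⟪p.2, q.1⟫_ℂ = ⟪p.1, q.2⟫_ℂ := by
  refine inner_eq_of_mem_closure_left (fun p' hp' => ?_) hp
  have := inner_eq_of_mem_closure_left (q := p') (fun q' hq' => ?_) hq
  · rw [← inner_conj_symm, ← this, inner_conj_symm]
  · rw [← inner_conj_symm, ← h p' hp' q' hq', inner_conj_symm]

theorem snd_mem_of_mem_closure {S : Set (E × F)} {C : Submodule ℂ F}
    (hC : IsClosed (C : Set F)) (h : ∀ p ∈ S, p.2 ∈ C) {p : E × F}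
    (hp : p ∈ (Submodule.span ℂ S).topologicalClosure) : p.2 ∈ C :=
  Submodule.topologicalClosure_minimal (t := C.comap (LinearMap.snd ℂ E F)) _
    (Submodule.span_le.mpr h) (hC.preimage continuous_snd) hp

theorem eq_zero_of_orthogonal {D : Set F} {w : F}
    (hw : w ∈ (Submodule.span ℂ D).topologicalClosure) (h : ∀ d ∈ D, ⟪w, d⟫_ℂ = 0) : w = 0 := by
  have hle : (Submodule.span ℂ D).topologicalClosure ≤ (innerSL ℂ w).ker :=
    Submodule.topologicalClosure_minimal _ (Submodule.span_le.mpr fun d hd => by simpa using h d hd)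
      (innerSL ℂ w).isClosed_ker
  simpa using hle hw

/-- Closability: a limit pair `(0, y)` has `y` orthogonal to all arguments of `S'`, while `y` also
lies in their closed span, so `y = 0`. Only the values of `S` need be approximated, so `S'` need not
have dense domain. If the closure were not a graph, `closedOp` would take a default value. -/
theorem AdjPair.graph_closedOp {S : Set (E × F)} {S' : Set (F × E)} (h : AdjPair S S') :
    (closedOp S).graph = (Submodule.span ℂ S).topologicalClosure := by
  refine Submodule.toLinearPMap_graph_eq _ fun p hp hp0 => ?_
  refine eq_zero_of_orthogonal
    (snd_mem_of_mem_closure (Submodule.isClosed_topologicalClosure _) h.range_le hp) ?_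
  rintro _ ⟨q, hq, rfl⟩
  rw [inner_eq_of_mem_closure_left (fun p hp => h.inner_eq p hp q hq) hp, hp0, inner_zero_left]

theorem AdjPair.mem_graph {S : Set (E × F)} {S' : Set (F × E)} (h : AdjPair S S') {p : E × F}
    (hp : p ∈ S) : p ∈ (closedOp S).graph := by
  rw [h.graph_closedOp]
  exact Submodule.le_topologicalClosure _ (Submodule.subset_span hp)

/-- The pairing survives closure, so closed operators can be fed into further constructions, such as
`tensorOp` of `dGamma` of a `tensorOp`. -/
theorem AdjPair.graph {S : Set (E × F)} {S' : Set (F × E)} (h : AdjPair S S')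
    (h' : AdjPair S' S) :
    AdjPair ((closedOp S).graph : Set (E × F)) ((closedOp S').graph : Set (F × E)) where
  inner_eq p hp q hq := by
    rw [h.graph_closedOp] at hp
    rw [h'.graph_closedOp] at hq
    exact inner_eq_of_mem_closure h.inner_eq hp hq
  range_le p hp := by
    rw [h.graph_closedOp] at hp
    refine snd_mem_of_mem_closure (Submodule.isClosed_topologicalClosure _) (fun p hp => ?_) hp
    refine Submodule.topologicalClosure_mono (Submodule.span_mono ?_) (h.range_le p hp)
    exact Set.image_mono fun q hq => h'.mem_graph hq

theorem adjPair_ofB [CompleteSpace E] [CompleteSpace F] (A : E →L[ℂ] F) :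
    AdjPair ((ofB A).graph : Set (E × F)) ((ofB A.adjoint).graph : Set (F × E)) where
  inner_eq := by
    rintro ⟨x, y⟩ hp ⟨x', y'⟩ hq
    obtain rfl := mem_graph_ofB.mp hp
    obtain rfl := mem_graph_ofB.mp hq
    exact (A.adjoint_inner_right x x').symm
  range_le p _ :=
    Submodule.le_topologicalClosure _ (Submodule.subset_span ⟨(p.2, _), mem_graph_ofB.mpr rfl, rfl⟩)

theorem adjPair_of_isSelfAdjoint [CompleteSpace E] {A : E →ₗ.[ℂ] E} (hA : IsSelfAdjoint A) :
    AdjPair (A.graph : Set (E × E)) (A.graph : Set (E × E)) where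
  inner_eq := by
    have h := LinearPMap.adjoint_isFormalAdjoint hA.dense_domain
    rw [LinearPMap.isSelfAdjoint_def.mp hA] at h
    rintro ⟨_, _⟩ hp ⟨_, _⟩ hq
    obtain ⟨x, rfl, rfl⟩ := (LinearPMap.mem_graph_iff _).mp hp
    obtain ⟨y, rfl, rfl⟩ := (LinearPMap.mem_graph_iff _).mp hq
    exact h x y
  range_le p _ := by
    have : (A.domain : Set E) ⊆ Prod.fst '' (A.graph : Set (E × E)) := fun x hx =>
      ⟨(x, A ⟨x, hx⟩), A.mem_graph ⟨x, hx⟩, rfl⟩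
    refine closure_mono ?_ (hA.dense_domain p.2)
    exact this.trans Submodule.subset_span

theorem adjPair_tensor {E' F' : Type*} [NormedAddCommGroup E'] [InnerProductSpace ℂ E']
    [NormedAddCommGroup F'] [InnerProductSpace ℂ F'] {A : E →ₗ.[ℂ] F} {B : E' →ₗ.[ℂ] F'}
    {A' : F →ₗ.[ℂ] E} {B' : F' →ₗ.[ℂ] E'}
    (hA : AdjPair (A.graph : Set (E × F)) (A'.graph : Set (F × E)))
    (hB : AdjPair (B.graph : Set (E' × F')) (B'.graph : Set (F' × E'))) :
    AdjPair {p : HTensor E E' × HTensor F F' | ∃ (x : A.domain) (y : B.domain),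
        p = (tmulH (x : E) (y : E'), tmulH (A x) (B y))}
      {p : HTensor F F' × HTensor E E' | ∃ (x : A'.domain) (y : B'.domain),
        p = (tmulH (x : F) (y : F'), tmulH (A' x) (B' y))} where
  inner_eq := by
    rintro _ ⟨x, y, rfl⟩ _ ⟨x', y', rfl⟩
    have h1 := hA.inner_eq _ (A.mem_graph x) _ (A'.mem_graph x')
    have h2 := hB.inner_eq _ (B.mem_graph y) _ (B'.mem_graph y')
    simp only at h1 h2
    simp only [inner_tmulH, h1, h2]
  range_le := by
    rintro _ ⟨x, y, rfl⟩
    refine tmulH_mem_closure_span (Submodule.isClosed_topologicalClosure _) ?_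
      (hA.range_le _ (A.mem_graph x)) (hB.range_le _ (B.mem_graph y))
    rintro _ ⟨⟨u, u'⟩, hu, rfl⟩ _ ⟨⟨v, v'⟩, hv, rfl⟩
    obtain ⟨a, rfl, rfl⟩ := (LinearPMap.mem_graph_iff _).mp hu
    obtain ⟨b, rfl, rfl⟩ := (LinearPMap.mem_graph_iff _).mp hv
    exact Submodule.le_topologicalClosure _ (Submodule.subset_span ⟨_, ⟨a, b, rfl⟩, rfl⟩)

theorem mem_graph_tensorOp {E' F' : Type*} [NormedAddCommGroup E'] [InnerProductSpace ℂ E']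
    [NormedAddCommGroup F'] [InnerProductSpace ℂ F'] {A : E →ₗ.[ℂ] F} {B : E' →ₗ.[ℂ] F'}
    {A' : F →ₗ.[ℂ] E} {B' : F' →ₗ.[ℂ] E'}
    (hA : AdjPair (A.graph : Set (E × F)) (A'.graph : Set (F × E)))
    (hB : AdjPair (B.graph : Set (E' × F')) (B'.graph : Set (F' × E')))
    {x : E} {x' : F} {y : E'} {y' : F'} (hx : (x, x') ∈ A.graph) (hy : (y, y') ∈ B.graph) :
    (tmulH x y, tmulH x' y') ∈ (tensorOp A B).graph := by
  obtain ⟨x, rfl, rfl⟩ := (LinearPMap.mem_graph_iff _).mp hx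
  obtain ⟨y, rfl, rfl⟩ := (LinearPMap.mem_graph_iff _).mp hy
  exact (adjPair_tensor hA hB).mem_graph ⟨x, y, rfl⟩

end Graphs

/-! ### Exponentials -/

section Exponential

variable {E : Type*} [NormedAddCommGroup E] [InnerProductSpace ℂ E] [CompleteSpace E]

theorem summable_factorial_succ {E : Type*} [NormedAddCommGroup E] {u : ℕ → E}
    (h : ∀ r : ℝ, Summable fun n => r ^ n / n.factorial * ‖u n‖) (r : ℝ) :
    Summable fun n => r ^ n / n.factorial * ‖u (n + 1)‖ := by
  -- With `R ≥ 1` and `n + 1 ≤ 2 ^ (n + 1)`, the coefficient `|r|ⁿ/n!` is at most `(2R)ⁿ⁺¹/(n+1)!`,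
  -- so the shifted series is dominated by the original one at radius `2R`.
  set R := max |r| 1
  have hR : 1 ≤ R := le_max_right _ _
  refine Summable.of_norm_bounded ((summable_nat_add_iff 1).mpr (h (2 * R))) fun n => ?_
  have h2 : ((n : ℝ) + 1) ≤ 2 ^ (n + 1) := by
    exact_mod_cast Nat.lt_two_pow_self.le
  rw [norm_mul, norm_norm, norm_div, norm_pow, Real.norm_eq_abs, Real.norm_natCast]
  gcongr ?_ * _
  rw [Nat.factorial_succ, Nat.cast_mul, div_le_div_iff₀ (by positivity) (by positivity), mul_pow]
  have h1 : |r| ^ n ≤ R ^ (n + 1) :=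
    (pow_le_pow_left₀ (abs_nonneg _) (le_max_left _ _) n).trans (pow_le_pow_right₀ hR (by simp))
  have h3 : (0 : ℝ) ≤ n.factorial := by positivity
  calc |r| ^ n * (((n + 1 : ℕ) : ℝ) * n.factorial)
      ≤ R ^ (n + 1) * (2 ^ (n + 1) * n.factorial) := by
        push_cast
        gcongr
    _ = _ := by ring

theorem summable_exp_series {u : ℕ → E}
    (h : ∀ r : ℝ, Summable fun n => r ^ n / n.factorial * ‖u n‖) (z : ℂ) :
    Summable fun n => (z ^ n / n.factorial) • u n := by
  refine Summable.of_norm_bounded (h ‖z‖) fun n => ?_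
  rw [norm_smul, norm_div, norm_pow, Complex.norm_natCast]

/-- Symmetry moves powers of `A` across the inner product term by term. The range condition holds
because each `Aⁿ v` of an entire analytic vector is again entire analytic, and the exponential is a
limit of combinations of these. Density of the analytic vectors is therefore not required, and `A`
need only be symmetric. -/
theorem adjPair_exp {A : E →ₗ.[ℂ] E}
    (hA : ∀ p ∈ A.graph, ∀ q ∈ A.graph, ⟪p.2, q.1⟫_ℂ = ⟪p.1, q.2⟫_ℂ) (z z' : ℂ)
    (hz : star z = z') :
    AdjPair {p : E × E | ∃ u : ℕ → E, (∀ n, (u n, u (n + 1)) ∈ A.graph) ∧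
        (∀ r : ℝ, Summable fun n => r ^ n / n.factorial * ‖u n‖) ∧
        p = (u 0, ∑' n, (z ^ n / n.factorial) • u n)}
      {p : E × E | ∃ u : ℕ → E, (∀ n, (u n, u (n + 1)) ∈ A.graph) ∧
        (∀ r : ℝ, Summable fun n => r ^ n / n.factorial * ‖u n‖) ∧
        p = (u 0, ∑' n, (z' ^ n / n.factorial) • u n)} where
  inner_eq := by
    rintro _ ⟨u, hu, hus, rfl⟩ _ ⟨v, hv, hvs, rfl⟩
    have key : ∀ n m, ⟪u n, v m⟫_ℂ = ⟪u 0, v (n + m)⟫_ℂ := by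
      intro n
      induction n with
      | zero => simp
      | succ n ih =>
        intro m
        rw [hA _ (hu n) _ (hv m), ih (m + 1)]
        congr 2
        ring
    have h1 := (innerSL ℂ (v 0)).hasSum (summable_exp_series hus z).hasSum
    have h2 := (innerSL ℂ (u 0)).hasSum (summable_exp_series hvs z').hasSum
    have h3 := h1.map (starRingEnd ℂ) Complex.continuous_conj
    simp only [innerSL_apply_apply, Function.comp_def, inner_conj_symm] at h1 h2 h3
    refine h3.unique ?_
    convert! h2 using 2 with n
    rw [inner_smul_left, inner_smul_right, key n 0, ← hz]
    simp
  range_le := by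
    rintro _ ⟨u, hu, hus, rfl⟩
    have key : ∀ n, (∀ r : ℝ, Summable fun k => r ^ k / k.factorial * ‖u (k + n)‖) := by
      intro n
      induction n with
      | zero => exact hus
      | succ n ih =>
        intro r
        have := summable_factorial_succ ih r
        simpa only [add_assoc, add_comm 1 n] using this
    refine (Submodule.isClosed_topologicalClosure _).mem_of_tendsto
      (summable_exp_series hus z).hasSum.tendsto_sum_nat (Filter.Eventually.of_forall fun N => ?_)
    refine Submodule.le_topologicalClosure _ (sum_mem fun n _ => Submodule.smul_mem _ _ ?_)
    refine Submodule.subset_span ⟨(u n, ∑' k, (z' ^ k / k.factorial) • u (k + n)),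
      ⟨fun k => u (k + n), fun k => ?_, key n, ?_⟩, rfl⟩
    · have := hu (k + n)
      rwa [add_right_comm] at this
    · simp

theorem mem_graph_expOp_of_eigen {A : E →ₗ.[ℂ] E}
    (hA : ∀ p ∈ A.graph, ∀ q ∈ A.graph, ⟪p.2, q.1⟫_ℂ = ⟪p.1, q.2⟫_ℂ) (z : ℂ) {c : ℂ} {v : E}
    (hv : (v, c • v) ∈ A.graph) : (v, Complex.exp (z * c) • v) ∈ (expOp z A).graph := by
  -- An eigenvector is entire analytic, with `Aⁿ v = cⁿ v`.
  refine (adjPair_exp hA z _ rfl).mem_graph ⟨fun n => c ^ n • v, fun n => ?_, fun r => ?_, ?_⟩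
  · have := A.graph.smul_mem (c ^ n) hv
    rwa [Prod.smul_mk, smul_smul, ← pow_succ] at this
  · have := (Real.summable_pow_div_factorial (r * ‖c‖)).mul_right ‖v‖
    refine this.congr fun n => ?_
    rw [norm_smul, norm_pow, mul_pow]
    ring
  · have h := (NormedSpace.expSeries_div_hasSum_exp (z * c)).smul_const v
    rw [← Complex.exp_eq_exp_ℂ] at h
    simp only [pow_zero, one_smul, Prod.mk.injEq, true_and]
    rw [← h.tsum_eq]
    congr 1
    ext n
    rw [smul_smul, mul_pow]
    ring_nf

theorem adjPair_expOp {A : E →ₗ.[ℂ] E}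
    (hA : ∀ p ∈ A.graph, ∀ q ∈ A.graph, ⟪p.2, q.1⟫_ℂ = ⟪p.1, q.2⟫_ℂ) (z z' : ℂ)
    (hz : star z = z') :
    AdjPair ((expOp z A).graph : Set (E × E)) ((expOp z' A).graph : Set (E × E)) :=
  (adjPair_exp hA z z' hz).graph (adjPair_exp hA z' z (by rw [← hz, star_star]))

end Exponential

end QuantumNoise
namespace QuantumNoise

/-! ### Symmetric tensors -/

section SymTensor

universe u

variable {H : Type u} [NormedAddCommGroup H] [InnerProductSpace ℂ H]

theorem inner_elemTensor : ∀ (n : ℕ) (v w : Fin n → H),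
    ⟪elemTensor n v, elemTensor n w⟫_ℂ = ∏ k, ⟪v k, w k⟫_ℂ
  | 0, v, w => by
    change ⟪(EuclideanSpace.single PUnit.unit (1 : ℂ) : EuclideanSpace ℂ PUnit.{u + 1}),
      EuclideanSpace.single PUnit.unit (1 : ℂ)⟫_ℂ = _
    simp
  | n + 1, v, w => by
    change ⟪(v 0 ⊗ₜ[ℂ] elemTensor n (Fin.tail v) : H ⊗[ℂ] (tensorPow H n).carrier),
      (w 0 ⊗ₜ[ℂ] elemTensor n (Fin.tail w) : H ⊗[ℂ] (tensorPow H n).carrier)⟫_ℂ = _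
    rw [TensorProduct.inner_tmul, inner_elemTensor n, Fin.prod_univ_succ]
    rfl

theorem elemTensor_smul : ∀ (n : ℕ) (c : Fin n → ℂ) (v : Fin n → H),
    elemTensor n (fun k => c k • v k) = (∏ k, c k) • elemTensor n v
  | 0, c, v => by
    rw [Fin.prod_univ_zero, one_smul]
    rfl
  | n + 1, c, v => by
    change ((c 0 • v 0) ⊗ₜ[ℂ] elemTensor n (fun k : Fin n => c k.succ • v k.succ) :
      H ⊗[ℂ] (tensorPow H n).carrier) =
      (∏ k, c k) • (v 0 ⊗ₜ[ℂ] elemTensor n (Fin.tail v) : H ⊗[ℂ] (tensorPow H n).carrier)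
    rw [elemTensor_smul n (fun k => c k.succ) (fun k => v k.succ), TensorProduct.smul_tmul,
      smul_smul, TensorProduct.tmul_smul, Fin.prod_univ_succ]
    rfl

theorem continuous_elemTensor : ∀ n : ℕ, Continuous (elemTensor (H := H) n)
  | 0 => continuous_const
  | n + 1 => by
    have h : Continuous fun v : Fin (n + 1) → H => (v 0, elemTensor n (Fin.tail v)) :=
      (continuous_apply 0).prodMk ((continuous_elemTensor n).comp
        (continuous_pi fun k => continuous_apply k.succ))
    exact (TensorProduct.continuous_tmul (𝕜 := ℂ)).comp h

theorem symTensor_comp_perm (n : ℕ) (v : Fin n → H) (τ : Equiv.Perm (Fin n)) :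
    symTensor n (v ∘ τ) = symTensor n v := by
  unfold symTensor
  congr 2
  exact Fintype.sum_equiv (Equiv.mulLeft τ) _ _ fun σ => rfl

theorem inner_symTensor (n : ℕ) (v w : Fin n → H) :
    ⟪symTensor n v, symTensor n w⟫_ℂ =
      (n.factorial : ℂ)⁻¹ * ∑ σ : Equiv.Perm (Fin n), ∏ k, ⟪v k, w (σ k)⟫_ℂ := by
  have hn : (n.factorial : ℂ) ≠ 0 := by exact_mod_cast n.factorial_ne_zero
  -- The sum over `τ` does not depend on `σ`, so the sum over `σ` gives `n!` and cancels one of the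
  -- two normalizing factors.
  have key : ∀ σ : Equiv.Perm (Fin n), ∑ τ : Equiv.Perm (Fin n),
      ⟪elemTensor n (v ∘ σ), elemTensor n (w ∘ τ)⟫_ℂ =
      ∑ τ : Equiv.Perm (Fin n), ∏ k, ⟪v k, w (τ k)⟫_ℂ := by
    intro σ
    refine Fintype.sum_equiv (Equiv.mulRight σ⁻¹) _ _ fun τ => ?_
    rw [inner_elemTensor]
    conv_rhs => rw [← Equiv.prod_comp σ]
    simp
  simp only [symTensor, UniformSpace.Completion.coe_toComplL,
    UniformSpace.Completion.inner_coe, inner_smul_left, inner_smul_right, sum_inner, inner_sum]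
  rw [← Finset.mul_sum, Finset.sum_comm]
  simp only [key]
  simp [Fintype.card_perm]
  field_simp
  simp

theorem symTensor_smul (n : ℕ) (c : Fin n → ℂ) (v : Fin n → H) :
    symTensor n (fun k => c k • v k) = (∏ k, c k) • symTensor n v := by
  unfold symTensor
  rw [← map_smul, smul_comm]
  refine congrArg _ (congrArg _ ?_)
  rw [Finset.smul_sum]
  refine Finset.sum_congr rfl fun σ _ => ?_
  rw [← Equiv.prod_comp σ]
  exact elemTensor_smul n (fun k => c (σ k)) (fun k => v (σ k))

theorem continuous_symTensor (n : ℕ) : Continuous (symTensor (H := H) n) := by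
  refine (UniformSpace.Completion.toComplL (𝕜 := ℂ)
    (E := (tensorPow H n).carrier)).continuous.comp (Continuous.const_smul ?_ _)
  exact continuous_finsetSum _ fun σ _ => (continuous_elemTensor n).comp
    (continuous_pi fun k => continuous_apply (σ k))

/-- This is the expansion of a permanent along its first row: permutations of `Fin (n + 1)` are
split by the image `i` of `0`. The remaining indices are enumerated by `swap 0 i` rather than by
`i.succAbove`, which differs by a permutation invisible to `symTensor`. -/
theorem inner_symTensor_cons (n : ℕ) (w₀ : H) (w : Fin n → H) (v : Fin (n + 1) → H) :
    ⟪symTensor (n + 1) (Fin.cons w₀ w : Fin (n + 1) → H), symTensor (n + 1) v⟫_ℂ =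
      ((n : ℂ) + 1)⁻¹ * ∑ i, ⟪w₀, v i⟫_ℂ * ⟪symTensor n w, symTensor n (i.removeNth v)⟫_ℂ := by
  have key : ∀ i : Fin (n + 1), ∃ ρ : Equiv.Perm (Fin n), ∀ k : Fin n,
      Equiv.swap 0 i k.succ = i.succAbove (ρ k) := by
    intro i
    refine Fin.cases ⟨1, fun k => by simp⟩ (fun j => ⟨j.cycleRange, fun k => ?_⟩) i
    rw [Fin.succAbove_cycleRange]
  have hsum : ∀ i : Fin (n + 1), ∑ e : Equiv.Perm (Fin n),
      ∏ k, ⟪w k, v (Equiv.swap 0 i (e k).succ)⟫_ℂ =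
      n.factorial * ⟪symTensor n w, symTensor n (i.removeNth v)⟫_ℂ := by
    intro i
    obtain ⟨ρ, hρ⟩ := key i
    have hn : (n.factorial : ℂ) ≠ 0 := by exact_mod_cast n.factorial_ne_zero
    rw [← symTensor_comp_perm n (i.removeNth v) ρ, inner_symTensor, mul_inv_cancel_left₀ hn]
    simp only [hρ]
    rfl
  rw [inner_symTensor, ← Equiv.sum_comp Equiv.Perm.decomposeFin.symm, Fintype.sum_prod_type,
    Nat.factorial_succ]
  simp only [Fin.prod_univ_succ, Equiv.Perm.decomposeFin_symm_apply_zero,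
    Equiv.Perm.decomposeFin_symm_apply_succ, Fin.cons_zero, Fin.cons_succ, ← Finset.mul_sum, hsum]
  have hn : (n.factorial : ℂ) ≠ 0 := by exact_mod_cast n.factorial_ne_zero
  push_cast
  rw [mul_inv, mul_assoc, Finset.mul_sum]
  congr 1
  refine Finset.sum_congr rfl fun i _ => ?_
  field_simp

/-! ### Vectors of the Fock space -/

theorem inner_symVec (n : ℕ) (v w : Fin n → H) :
    ⟪symVec n v, symVec n w⟫_ℂ = ⟪symTensor n v, symTensor n w⟫_ℂ := by
  unfold symVec
  rw [lp.inner_single_left, lp.single_apply_self]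
  rfl

theorem inner_symVec_of_ne {n m : ℕ} (hnm : n ≠ m) (v : Fin n → H) (w : Fin m → H) :
    ⟪symVec n v, symVec m w⟫_ℂ = 0 := by
  unfold symVec
  rw [lp.inner_single_left, lp.single_apply_ne _ _ _ hnm, inner_zero_right]

theorem symVec_zero (v : Fin 0 → H) : symVec 0 v = vacuum H := by
  rw [vacuum, Subsingleton.elim v]

@[simp]
theorem inner_vacuum_vacuum : ⟪vacuum H, vacuum H⟫_ℂ = 1 := by
  rw [vacuum, inner_symVec, inner_symTensor]
  simp

theorem symVec_smul (n : ℕ) (c : Fin n → ℂ) (v : Fin n → H) :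
    symVec n (fun k => c k • v k) = (∏ k, c k) • symVec n v := by
  unfold symVec
  rw [← lp.single_smul]
  congr 1
  exact Subtype.ext (symTensor_smul n c v)

theorem symVec_update_smul (n : ℕ) (v : Fin n → H) (i : Fin n) (c : ℂ) :
    symVec n (Function.update v i (c • v i)) = c • symVec n v := by
  have h := symVec_smul n (fun k => if k = i then c else 1) v
  rw [Finset.prod_ite_eq' Finset.univ i fun _ => c] at h
  simp only [Finset.mem_univ, if_true] at h
  rw [← h]
  congr 1
  ext k
  by_cases hk : k = i
  · subst hk; simp
  · simp [hk]

theorem continuous_symVec (n : ℕ) : Continuous (symVec (H := H) n) :=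
  (lp.singleContinuousLinearMap ℂ (fun n => symPow H n) 2 n).continuous.comp
    ((continuous_symTensor n).subtype_mk _)

theorem inner_symVec_cons (n : ℕ) (w₀ : H) (w : Fin n → H) (v : Fin (n + 1) → H) :
    ⟪symVec (n + 1) (Fin.cons w₀ w : Fin (n + 1) → H), symVec (n + 1) v⟫_ℂ =
      ((n : ℂ) + 1)⁻¹ * ∑ i, ⟪w₀, v i⟫_ℂ * ⟪symVec n w, symVec n (i.removeNth v)⟫_ℂ := by
  simp only [inner_symVec, inner_symTensor_cons]

theorem closure_span_symVec :
    (Submodule.span ℂ {x : Fock H | ∃ n v, x = symVec n v}).topologicalClosure = ⊤ := by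
  set C := (Submodule.span ℂ {x : Fock H | ∃ n v, x = symVec n v}).topologicalClosure
  have hC : IsClosed (C : Set (Fock H)) := Submodule.isClosed_topologicalClosure _
  have hsingle : ∀ n (a : symPow H n), lp.single 2 n a ∈ C := by
    intro n a
    let ι : symPow H n →L[ℂ] Fock H := lp.singleContinuousLinearMap ℂ (fun n => symPow H n) 2 n
    have h1 : ∀ x (hx : x ∈ Submodule.span ℂ (Set.range (symTensor (H := H) n))),
        ι ⟨x, Submodule.le_topologicalClosure _ hx⟩ ∈ C := by
      intro x hx
      induction hx using Submodule.span_induction with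
      | mem x hx =>
        obtain ⟨v, rfl⟩ := hx
        exact Submodule.le_topologicalClosure _ (Submodule.subset_span ⟨n, v, rfl⟩)
      | zero => exact (map_zero ι).symm ▸ C.zero_mem
      | add x y hx hy h1 h2 =>
        have := C.add_mem h1 h2
        rwa [← map_add] at this
      | smul c x hx h1 =>
        have := C.smul_mem c h1
        rwa [← map_smul] at this
    obtain ⟨a, ha⟩ := a
    obtain ⟨s, hs, hlim⟩ := mem_closure_iff_seq_limit.mp ha
    refine hC.mem_of_tendsto (f := fun k => ι ⟨s k, Submodule.le_topologicalClosure _ (hs k)⟩)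
      (b := Filter.atTop) ?_ (Filter.Eventually.of_forall fun k => h1 _ (hs k))
    exact (ι.continuous.tendsto _).comp (tendsto_subtype_rng.mpr hlim)
  refine eq_top_iff.mpr fun f _ => ?_
  exact hC.mem_of_tendsto (lp.hasSum_single (by simp) f)
    (Filter.Eventually.of_forall fun s => sum_mem fun n _ => hsingle n _)

/-! ### Second quantization -/

theorem adjPair_dGamma {h : H →ₗ.[ℂ] H}
    (hh : AdjPair (h.graph : Set (H × H)) (h.graph : Set (H × H))) :
    AdjPair {p : Fock H × Fock H | ∃ (n : ℕ) (v : Fin n → h.domain),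
        p = (symVec n (fun i => (v i : H)),
          ∑ i, symVec n (Function.update (fun j => (v j : H)) i (h (v i))))}
      {p : Fock H × Fock H | ∃ (n : ℕ) (v : Fin n → h.domain),
        p = (symVec n (fun i => (v i : H)),
          ∑ i, symVec n (Function.update (fun j => (v j : H)) i (h (v i))))} where
  inner_eq := by
    rintro _ ⟨n, v, rfl⟩ _ ⟨m, w, rfl⟩
    by_cases hnm : n = m
    · subst hnm
      simp only [sum_inner, inner_sum, inner_symVec, inner_symTensor, ← Finset.mul_sum]
      congr 1
      rw [Finset.sum_comm]
      conv_rhs => rw [Finset.sum_comm]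
      refine Finset.sum_congr rfl fun σ _ => ?_
      -- Under `σ`, slot `i` of `v` is paired with slot `σ i` of `w`, so symmetry of `h` is used in
      -- this one factor.
      conv_rhs => rw [← Equiv.sum_comp σ]
      refine Finset.sum_congr rfl fun i _ => Finset.prod_congr rfl fun k _ => ?_
      by_cases hk : k = i
      · subst hk
        simpa using hh.inner_eq _ (h.mem_graph (v k)) _ (h.mem_graph (w (σ k)))
      · simp [hk]
    · simp [inner_symVec_of_ne hnm]
  range_le := by
    rintro _ ⟨n, v, rfl⟩
    dsimp only
    refine Submodule.sum_mem _ fun i _ => ?_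
    -- `h (v i)` may leave the domain of `h`. It is only a limit of domain vectors, and continuity
    -- of `symVec` in slot `i` carries this over to the Fock space.
    have hd : h (v i) ∈ closure (h.domain : Set H) := by
      have := hh.range_le _ (h.mem_graph (v i))
      refine closure_mono ?_ this
      refine (Submodule.span_le (p := h.domain)).mpr ?_
      rintro _ ⟨⟨x, y⟩, hxy, rfl⟩
      exact LinearPMap.mem_domain_of_mem_graph hxy
    refine map_mem_closure (s := (h.domain : Set H))
      (f := fun x => symVec n (Function.update (fun j => (v j : H)) i x))
      ((continuous_symVec n).comp (continuous_const.update i continuous_id)) hd fun x hx => ?_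
    refine Submodule.subset_span ⟨_, ⟨n, Function.update v i ⟨x, hx⟩, rfl⟩, ?_⟩
    simp only
    congr 1
    ext k
    by_cases hk : k = i
    · subst hk; simp
    · simp [hk]

theorem mem_graph_dGamma_of_eigen {h : H →ₗ.[ℂ] H}
    (hh : AdjPair (h.graph : Set (H × H)) (h.graph : Set (H × H))) {n : ℕ} {v : Fin n → H}
    {c : Fin n → ℂ} (hv : ∀ i, (v i, c i • v i) ∈ h.graph) :
    (symVec n v, (∑ i, c i) • symVec n v) ∈ (dGamma h).graph := by
  have hval : ∀ i, h ⟨v i, LinearPMap.mem_domain_of_mem_graph (hv i)⟩ = c i • v i := fun i =>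
    LinearPMap.mem_graph_snd_inj _ (h.mem_graph _) (hv i) rfl
  refine (adjPair_dGamma hh).mem_graph
    ⟨n, fun i => ⟨v i, LinearPMap.mem_domain_of_mem_graph (hv i)⟩, ?_⟩
  simp only [hval, symVec_update_smul, Finset.sum_smul]

end SymTensor

end QuantumNoise
namespace QuantumNoise

/-! ### Bounded self-adjoint operators, linear combinations in a graph, exponentials on eigenvectors
-/

theorem adjPair_ofB_self {E : Type*} [NormedAddCommGroup E] [InnerProductSpace ℂ E]
    [CompleteSpace E] {A : E →L[ℂ] E} (hA : IsSelfAdjoint A) :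
    AdjPair ((ofB A).graph : Set (E × E)) ((ofB A).graph : Set (E × E)) := by
  have h := adjPair_ofB A
  rwa [ContinuousLinearMap.isSelfAdjoint_iff'.mp hA] at h

theorem adjPair_ofB_id (E : Type*) [NormedAddCommGroup E] [InnerProductSpace ℂ E]
    [CompleteSpace E] :
    AdjPair ((ofB (ContinuousLinearMap.id ℂ E)).graph : Set (E × E))
      ((ofB (ContinuousLinearMap.id ℂ E)).graph : Set (E × E)) :=
  adjPair_ofB_self (IsSelfAdjoint.one _)

theorem sum_smul_mem_graph {E F ι : Type*} [Fintype ι] [AddCommGroup E] [Module ℂ E]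
    [AddCommGroup F] [Module ℂ F] {f : E →ₗ.[ℂ] F} (c : ι → ℂ) {x : ι → E} {y : ι → F}
    (h : ∀ i, (x i, y i) ∈ f.graph) : (∑ i, c i • x i, ∑ i, c i • y i) ∈ f.graph := by
  convert! Submodule.sum_mem f.graph fun i (_ : i ∈ Finset.univ) =>
    f.graph.smul_mem (c i) (h i) using 1
  simp [Prod.ext_iff, Prod.fst_sum, Prod.snd_sum]

theorem exp_apply_eigen {E : Type*} [NormedAddCommGroup E] [NormedSpace ℂ E]
    [CompleteSpace E] {A : E →L[ℂ] E} {c : ℂ} {v : E} (hv : A v = c • v) (z : ℂ) :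
    NormedSpace.exp (z • A) v = Complex.exp (z * c) • v := by
  have h1 := (NormedSpace.exp_series_hasSum_exp' (𝕂 := ℂ) (z • A)).mapL
    (ContinuousLinearMap.apply ℂ E v)
  have h2 := (NormedSpace.exp_series_hasSum_exp' (𝕂 := ℂ) (z * c)).smul_const v
  rw [← Complex.exp_eq_exp_ℂ] at h2
  refine h1.unique ?_
  convert! h2 using 2 with n
  have hpow : ∀ n : ℕ, ((z • A) ^ n) v = (z * c) ^ n • v := by
    intro n
    induction n with
    | zero => simp
    | succ n ih =>
      rw [pow_succ', mul_apply_eq_comp, ih, map_smul, smul_apply,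
        hv, smul_smul, smul_smul, pow_succ, mul_assoc]
  simp [hpow, smul_smul]

/-! ### Creation and annihilation operators -/

section Fock

variable {H : Type*} [NormedAddCommGroup H] [InnerProductSpace ℂ H] [CompleteSpace H]
  {𝒦 : Type*} [NormedAddCommGroup 𝒦] [InnerProductSpace ℂ 𝒦] [CompleteSpace 𝒦]
  {ι : Type*} [Fintype ι]

/-- The second set is the explicit formula for `a*(V)` on symmetric tensors. It pairs with the
definition of `a(V)` by the first-row expansion `inner_symVec_cons`. This gives at once closability
of `a(V)` and the action of its adjoint. -/
theorem adjPair_annih (e : OrthonormalBasis ι ℂ 𝒦) (V : 𝒦 →L[ℂ] HTensor 𝒦 H) :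
    AdjPair ({p | ∃ k : 𝒦, p = (tmulH k (vacuum H), 0)} ∪
        {p : HTensor 𝒦 (Fock H) × HTensor 𝒦 (Fock H) | ∃ (n : ℕ) (k : 𝒦) (v : Fin (n + 1) → H),
          p = (tmulH k (symVec (n + 1) v), (√((n : ℝ) + 1) : ℂ) • (((n : ℂ) + 1)⁻¹ •
            ∑ i, tmulH (V.adjoint (tmulH k (v i))) (symVec n (i.removeNth v))))})
      {q : HTensor 𝒦 (Fock H) × HTensor 𝒦 (Fock H) | ∃ (n : ℕ) (x : 𝒦) (w : Fin n → H),
        q = (tmulH x (symVec n w), (√((n : ℝ) + 1) : ℂ) •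
          ∑ j, tmulH (e j) (symVec (n + 1) (Fin.cons (slice (e j) (V x)) w : Fin (n + 1) → H)))}
    where
  inner_eq := by
    rintro _ (⟨k, rfl⟩ | ⟨n, k, v, rfl⟩) _ ⟨m, x, w, rfl⟩
    · simp [vacuum, inner_symVec_of_ne (Nat.succ_ne_zero m).symm]
    · by_cases hnm : n = m
      · subst hnm
        have hV : ∀ i, ⟪V.adjoint (tmulH k (v i)), x⟫_ℂ =
            ∑ j, ⟪k, e j⟫_ℂ * ⟪v i, slice (e j) (V x)⟫_ℂ := by
          intro i
          rw [ContinuousLinearMap.adjoint_inner_left]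
          conv_lhs => rw [← sum_tmulH_slice e (V x)]
          simp only [inner_sum, inner_tmulH]
        have hS : ∀ j, ⟪symVec (n + 1) v,
            symVec (n + 1) (Fin.cons (slice (e j) (V x)) w : Fin (n + 1) → H)⟫_ℂ =
            ((n : ℂ) + 1)⁻¹ * ∑ i, ⟪v i, slice (e j) (V x)⟫_ℂ *
              ⟪symVec n (i.removeNth v), symVec n w⟫_ℂ := by
          intro j
          rw [← inner_conj_symm, inner_symVec_cons]
          simp [map_sum, inner_conj_symm]
        simp only [inner_smul_left, inner_smul_right, sum_inner, inner_sum, inner_tmulH, hV, hS]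
        simp only [Complex.conj_ofReal, map_inv₀, map_add, map_natCast, map_one, Finset.mul_sum,
          Finset.sum_mul]
        rw [Finset.sum_comm]
        refine Finset.sum_congr rfl fun j _ => Finset.sum_congr rfl fun i _ => ?_
        ring
      · simp [inner_symVec_of_ne hnm,
          inner_symVec_of_ne (fun h => hnm (Nat.succ_injective h))]
  range_le := by
    rintro _ (⟨k, rfl⟩ | ⟨n, k, v, rfl⟩)
    · exact zero_mem _
    · refine Submodule.le_topologicalClosure _ (Submodule.smul_mem _ _ (Submodule.smul_mem _ _ ?_))
      exact Submodule.sum_mem _ fun i _ => Submodule.subset_span ⟨_, ⟨n, _, _, rfl⟩, rfl⟩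

theorem mem_graph_annih_one [FiniteDimensional ℂ 𝒦] (V : 𝒦 →L[ℂ] HTensor 𝒦 H) (x : 𝒦) (b : H) :
    (tmulH x (symVec 1 (Fin.cons b Fin.elim0 : Fin 1 → H)),
      tmulH (V.adjoint (tmulH x b)) (vacuum H)) ∈ (annih V).graph := by
  refine (adjPair_annih (stdOrthonormalBasis ℂ 𝒦) V).mem_graph
    (Or.inr ⟨0, x, (Fin.cons b Fin.elim0 : Fin 1 → H), ?_⟩)
  simp [symVec_zero]

theorem mem_graph_annih_vacuum [FiniteDimensional ℂ 𝒦] (V : 𝒦 →L[ℂ] HTensor 𝒦 H) (x : 𝒦) :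
    (tmulH x (vacuum H), 0) ∈ (annih V).graph :=
  (adjPair_annih (stdOrthonormalBasis ℂ 𝒦) V).mem_graph (Or.inl ⟨x, rfl⟩)

/-- Density is what gives `creat` content: the adjoint of an operator that is not densely defined
takes a default value. -/
theorem dense_domain_annih [FiniteDimensional ℂ 𝒦] (V : 𝒦 →L[ℂ] HTensor 𝒦 H) :
    Dense ((annih V).domain : Set (HTensor 𝒦 (Fock H))) := by
  have hmem : ∀ x ∈ (Set.univ : Set 𝒦), ∀ y ∈ {y : Fock H | ∃ n v, y = symVec n v},
      tmulH x y ∈ (annih V).domain.topologicalClosure := by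
    rintro x - _ ⟨n, v, rfl⟩
    refine Submodule.le_topologicalClosure _ ?_
    cases n with
    | zero =>
      rw [symVec_zero]
      exact LinearPMap.mem_domain_of_mem_graph (mem_graph_annih_vacuum V x)
    | succ n =>
      exact LinearPMap.mem_domain_of_mem_graph
        ((adjPair_annih (stdOrthonormalBasis ℂ 𝒦) V).mem_graph (Or.inr ⟨n, x, v, rfl⟩))
  rw [Submodule.dense_iff_topologicalClosure_eq_top, eq_top_iff]
  refine fun z _ => mem_of_forall_tmulH (Submodule.isClosed_topologicalClosure _) (fun x y => ?_) z
  refine tmulH_mem_closure_span (Submodule.isClosed_topologicalClosure _) hmem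
    (Submodule.le_topologicalClosure _ (Submodule.subset_span (Set.mem_univ x))) ?_
  rw [closure_span_symVec]
  exact Submodule.mem_top

theorem mem_graph_creat [FiniteDimensional ℂ 𝒦] (e : OrthonormalBasis ι ℂ 𝒦)
    (V : 𝒦 →L[ℂ] HTensor 𝒦 H) (x : 𝒦) {n : ℕ} (w : Fin n → H) :
    (tmulH x (symVec n w), (√((n : ℝ) + 1) : ℂ) •
      ∑ j, tmulH (e j) (symVec (n + 1) (Fin.cons (slice (e j) (V x)) w : Fin (n + 1) → H))) ∈
      (creat V).graph := by
  rw [creat, LinearPMap.adjoint_graph_eq_graph_adjoint (dense_domain_annih V),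
    Submodule.mem_adjoint_iff]
  intro a b hab
  rw [annih, (adjPair_annih e V).graph_closedOp] at hab
  exact sub_eq_zero.mpr (inner_eq_of_mem_closure_left
    (fun p hp => (adjPair_annih e V).inner_eq p hp _ ⟨n, x, w, rfl⟩) hab)

end Fock

/-! ### The total energy -/

section Energy

variable {𝒦 𝔥 : Type*} [NormedAddCommGroup 𝒦] [InnerProductSpace ℂ 𝒦] [CompleteSpace 𝒦]
  [NormedAddCommGroup 𝔥] [InnerProductSpace ℂ 𝔥] [CompleteSpace 𝔥]

theorem isSelfAdjoint_tensorB {A : 𝒦 →L[ℂ] 𝒦} {H : Type*} [NormedAddCommGroup H]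
    [InnerProductSpace ℂ H] (hA : IsSelfAdjoint A) :
    IsSelfAdjoint (tensorB A (ContinuousLinearMap.id ℂ H)) := by
  rw [ContinuousLinearMap.isSelfAdjoint_iff']
  refine clm_ext_tmulH fun x y => ?_
  refine eq_of_sub_eq_zero (eq_zero_of_orthogonal
    (D := {z : HTensor 𝒦 H | ∃ (x : 𝒦) (y : H), z = tmulH x y}) ?_ ?_)
  · rw [closure_span_tmulH]
    exact Submodule.mem_top
  · rintro _ ⟨x', y', rfl⟩
    have hs : ⟪A x, x'⟫_ℂ = ⟪x, A x'⟫_ℂ := by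
      conv_lhs => rw [← ContinuousLinearMap.isSelfAdjoint_iff'.mp hA]
      exact A.adjoint_inner_left _ _
    rw [inner_sub_left, ContinuousLinearMap.adjoint_inner_left, tensorB_tmulH, tensorB_tmulH,
      inner_tmulH, inner_tmulH, hs]
    exact sub_self _

theorem adjPair_id_tensorOp {H : Type*} [NormedAddCommGroup H] [InnerProductSpace ℂ H]
    {h : H →ₗ.[ℂ] H} (hh : AdjPair (h.graph : Set (H × H)) (h.graph : Set (H × H))) :
    AdjPair ((tensorOp (ofB (ContinuousLinearMap.id ℂ 𝒦)) h).graph :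
        Set (HTensor 𝒦 H × HTensor 𝒦 H))
      ((tensorOp (ofB (ContinuousLinearMap.id ℂ 𝒦)) h).graph :
        Set (HTensor 𝒦 H × HTensor 𝒦 H)) :=
  (adjPair_tensor (adjPair_ofB_id 𝒦) hh).graph (adjPair_tensor (adjPair_ofB_id 𝒦) hh)

/-- The energy operator `K ⊗ 1 + 1 ⊗ dΓ(h)`. -/
noncomputable def energyOp {H : Type*} [NormedAddCommGroup H] [InnerProductSpace ℂ H]
    (K : 𝒦 →L[ℂ] 𝒦) (h : H →ₗ.[ℂ] H) : HTensor 𝒦 (Fock H) →ₗ.[ℂ] HTensor 𝒦 (Fock H) :=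
  ofB (tensorB K (ContinuousLinearMap.id ℂ _)) +
    tensorOp (ofB (ContinuousLinearMap.id ℂ 𝒦)) (dGamma h)

variable {H : Type*} [NormedAddCommGroup H] [InnerProductSpace ℂ H] {h : H →ₗ.[ℂ] H}

theorem adjPair_graph_dGamma (hh : AdjPair (h.graph : Set (H × H)) (h.graph : Set (H × H))) :
    AdjPair ((dGamma h).graph : Set (Fock H × Fock H))
      ((dGamma h).graph : Set (Fock H × Fock H)) :=
  (adjPair_dGamma hh).graph (adjPair_dGamma hh)

/-- Formal symmetry of the sum is all that `adjPair_exp` asks for. It holds on the intersection of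
the domains. -/
theorem inner_energyOp {K : 𝒦 →L[ℂ] 𝒦} (hK : IsSelfAdjoint K)
    (hh : AdjPair (h.graph : Set (H × H)) (h.graph : Set (H × H))) :
    ∀ p ∈ (energyOp K h).graph, ∀ q ∈ (energyOp K h).graph,
      ⟪p.2, q.1⟫_ℂ = ⟪p.1, q.2⟫_ℂ := by
  rintro ⟨x, _⟩ hp ⟨y, _⟩ hq
  obtain ⟨a, b, ha, hb, rfl⟩ := mem_graph_add.mp hp
  obtain ⟨a', b', ha', hb', rfl⟩ := mem_graph_add.mp hq
  simp only [inner_add_left, inner_add_right]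
  have h1 := (adjPair_ofB_self (isSelfAdjoint_tensorB hK)).inner_eq _ ha _ ha'
  have h2 := (adjPair_id_tensorOp (adjPair_graph_dGamma hh)).inner_eq _ hb _ hb'
  exact congrArg₂ (· + ·) h1 h2

theorem mem_graph_add_tensorOp {K : 𝒦 →L[ℂ] 𝒦}
    (hh : AdjPair (h.graph : Set (H × H)) (h.graph : Set (H × H)))
    {k c : ℂ} {x : 𝒦} (hx : K x = k • x) {s : H} (hs : (s, c • s) ∈ h.graph) :
    (tmulH x s, (k + c) • tmulH x s) ∈ (ofB (tensorB K (ContinuousLinearMap.id ℂ H)) +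
      tensorOp (ofB (ContinuousLinearMap.id ℂ 𝒦)) h).graph := by
  refine mem_graph_add.mpr ⟨k • tmulH x s, c • tmulH x s, ?_, ?_, (add_smul _ _ _).symm⟩
  · rw [mem_graph_ofB, tensorB_tmulH, hx, smul_tmulH]
    rfl
  · rw [← tmulH_smul]
    exact mem_graph_tensorOp (adjPair_ofB_id 𝒦) hh (mem_graph_ofB.mpr rfl) hs

/-- Here `x ⊗ s` need not be an eigenvector; expanding `x` in the eigenbasis of `K` makes it a
finite sum of eigenvectors. -/
theorem mem_graph_expOp_of_forall_eigen {ι : Type*} [Fintype ι] {K : 𝒦 →L[ℂ] 𝒦}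
    (e : OrthonormalBasis ι ℂ 𝒦) {κ : ι → ℝ} (he : ∀ i, K (e i) = (κ i : ℂ) • e i)
    {E : HTensor 𝒦 H →ₗ.[ℂ] HTensor 𝒦 H}
    (hE : ∀ p ∈ E.graph, ∀ q ∈ E.graph, ⟪p.2, q.1⟫_ℂ = ⟪p.1, q.2⟫_ℂ) {c : ℂ} {s : H}
    (hs : ∀ i, (tmulH (e i) s, ((κ i : ℂ) + c) • tmulH (e i) s) ∈ E.graph) (z : ℂ) (x : 𝒦) :
    (tmulH x s, Complex.exp (z * c) • tmulH (NormedSpace.exp (z • K) x) s) ∈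
      (expOp z E).graph := by
  have h1 : ∀ i, (tmulH (e i) s, Complex.exp (z * c) •
      tmulH (NormedSpace.exp (z • K) (e i)) s) ∈ (expOp z E).graph := by
    intro i
    have h := mem_graph_expOp_of_eigen hE z (hs i)
    rwa [mul_add, add_comm, Complex.exp_add, mul_smul, ← smul_tmulH,
      ← exp_apply_eigen (he i)] at h
  convert! sum_smul_mem_graph (fun i => ⟪e i, x⟫_ℂ) h1 using 1
  conv_lhs => rw [← e.sum_repr' x]
  simp only [sum_tmulH, smul_tmulH, map_sum, map_smul,
    Finset.smul_sum, smul_comm (Complex.exp _)]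

theorem mem_graph_exp_energyOp {ι : Type*} [Fintype ι] {K : 𝒦 →L[ℂ] 𝒦} (hK : IsSelfAdjoint K)
    (hh : AdjPair (h.graph : Set (H × H)) (h.graph : Set (H × H)))
    (e : OrthonormalBasis ι ℂ 𝒦) {κ : ι → ℝ} (he : ∀ i, K (e i) = (κ i : ℂ) • e i) (z : ℂ)
    (x : 𝒦) {n : ℕ} {v : Fin n → H} {c : Fin n → ℂ} (hv : ∀ i, (v i, c i • v i) ∈ h.graph) :
    (tmulH x (symVec n v), Complex.exp (z * ∑ i, c i) •
      tmulH (NormedSpace.exp (z • K) x) (symVec n v)) ∈ (expOp z (energyOp K h)).graph :=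
  mem_graph_expOp_of_forall_eigen e he (inner_energyOp hK hh)
    (fun i => mem_graph_add_tensorOp (adjPair_graph_dGamma hh) (he i)
      (mem_graph_dGamma_of_eigen hh hv)) z x

theorem adjPair_noiseEnergy {Y : 𝔥 →ₗ.[ℂ] 𝔥} (hY : IsSelfAdjoint Y) :
    AdjPair ((tensorOp Y (ofB (ContinuousLinearMap.id ℂ L2R))).graph :
        Set (HTensor 𝔥 L2R × HTensor 𝔥 L2R))
      ((tensorOp Y (ofB (ContinuousLinearMap.id ℂ L2R))).graph :
        Set (HTensor 𝔥 L2R × HTensor 𝔥 L2R)) :=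
  (adjPair_tensor (adjPair_of_isSelfAdjoint hY) (adjPair_ofB_id L2R)).graph
    (adjPair_tensor (adjPair_of_isSelfAdjoint hY) (adjPair_ofB_id L2R))

end Energy

end QuantumNoise
namespace QuantumNoise


/-! ### Matrix elements of the coupling -/

section EigenData

variable {𝒦 𝔥 : Type*} [NormedAddCommGroup 𝒦] [InnerProductSpace ℂ 𝒦] [CompleteSpace 𝒦]
  [NormedAddCommGroup 𝔥] [InnerProductSpace ℂ 𝔥] [CompleteSpace 𝔥]

/-- An orthonormal eigenbasis `e` of `K` with eigenvalues `κ`, and the components `h j i ∈ 𝔥` of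
the coupling, `ν eᵢ = ∑ⱼ eⱼ ⊗ h j i`, which are eigenvectors of `Y`. -/
structure EigenData (K : 𝒦 →L[ℂ] 𝒦) (Y : 𝔥 →ₗ.[ℂ] 𝔥) (ν : 𝒦 →L[ℂ] HTensor 𝒦 𝔥)
    (ι : Type*) [Fintype ι] where
  /-- The eigenbasis. -/
  e : OrthonormalBasis ι ℂ 𝒦
  /-- The eigenvalues. -/
  κ : ι → ℝ
  /-- The components of the coupling. -/
  h : ι → ι → 𝔥
  apply_e : ∀ i, K (e i) = (κ i : ℂ) • e i
  mem_graph : ∀ j i, (h j i, ((κ i - κ j : ℝ) : ℂ) • h j i) ∈ Y.graph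
  apply_ν : ∀ i, ν (e i) = ∑ j, tmulH (e j) (h j i)

/-- Slicing maps the generators of the graph of `1 ⊗ Y` into the graph of `Y`. As `Y` is closed,
this extends to the closure. -/
theorem slice_mem_graph {Y : 𝔥 →ₗ.[ℂ] 𝔥} (hY : IsSelfAdjoint Y) (x : 𝒦)
    {p : HTensor 𝒦 𝔥 × HTensor 𝒦 𝔥}
    (hp : p ∈ (tensorOp (ofB (ContinuousLinearMap.id ℂ 𝒦)) Y).graph) :
    (slice x p.1, slice x p.2) ∈ Y.graph := by
  rw [tensorOp, (adjPair_tensor (adjPair_ofB_id 𝒦)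
    (adjPair_of_isSelfAdjoint hY)).graph_closedOp] at hp
  let s : HTensor 𝒦 𝔥 × HTensor 𝒦 𝔥 →L[ℂ] 𝔥 × 𝔥 := (slice x).prodMap (slice x)
  refine Submodule.topologicalClosure_minimal (t := Y.graph.comap s.toLinearMap) _
    (Submodule.span_le.mpr ?_) ((IsSelfAdjoint.isClosed hY).preimage s.continuous) hp
  rintro _ ⟨a, b, rfl⟩
  change (slice x (tmulH _ _), slice x (tmulH _ _)) ∈ Y.graph
  rw [slice_tmulH, slice_tmulH]
  exact Y.graph.smul_mem ⟪x, (a : 𝒦)⟫_ℂ (Y.mem_graph b)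

theorem slice_tensorB {K : 𝒦 →L[ℂ] 𝒦} (hK : IsSelfAdjoint K) {k : ℝ} {x : 𝒦}
    (hx : K x = (k : ℂ) • x) (z : HTensor 𝒦 𝔥) :
    slice x (tensorB K (ContinuousLinearMap.id ℂ 𝔥) z) = (k : ℂ) • slice x z := by
  have h : slice x ∘L tensorB K (ContinuousLinearMap.id ℂ 𝔥) = (k : ℂ) • slice x := by
    refine clm_ext_tmulH fun u y => ?_
    have hs : ⟪x, K u⟫_ℂ = k * ⟪x, u⟫_ℂ := by
      rw [← K.adjoint_inner_left, ContinuousLinearMap.isSelfAdjoint_iff'.mp hK, hx,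
        inner_smul_left, Complex.conj_ofReal]
    rw [ContinuousLinearMap.comp_apply, tensorB_tmulH, slice_tmulH, smul_apply, slice_tmulH, hs,
      mul_smul]
    rfl
  exact congrArg (fun f => f z) h

theorem exists_eigenData [FiniteDimensional ℂ 𝒦] {K : 𝒦 →L[ℂ] 𝒦} (hK : IsSelfAdjoint K)
    {Y : 𝔥 →ₗ.[ℂ] 𝔥} (hY : IsSelfAdjoint Y) {ν : 𝒦 →L[ℂ] HTensor 𝒦 𝔥}
    (hν : Intertwines K Y ν) : Nonempty (EigenData K Y ν (Fin (Module.finrank ℂ 𝒦))) := by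
  have hs := ContinuousLinearMap.isSelfAdjoint_iff_isSymmetric.mp hK
  set e := hs.eigenvectorBasis rfl
  have he : ∀ i, K (e i) = (hs.eigenvalues rfl i : ℂ) • e i := hs.apply_eigenvectorBasis rfl
  refine ⟨⟨e, hs.eigenvalues rfl, fun j i => slice (e j) (ν (e i)), he, fun j i => ?_,
    fun i => (sum_tmulH_slice e _).symm⟩⟩
  have h1 := ofB_eq_iff.mp hν (e i)
  obtain ⟨_, h2, h3⟩ := mem_graph_opMul.mp h1
  obtain rfl := mem_graph_ofB.mp h2
  obtain ⟨a, b, ha, hb, hab⟩ := mem_graph_add.mp h3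
  obtain rfl := mem_graph_ofB.mp ha
  have h4 := slice_mem_graph hY (e j) hb
  rw [ContinuousLinearMap.comp_apply, he, map_smul] at hab
  -- The relation gives `(1 ⊗ Y) ν eᵢ = κ i • ν eᵢ - (K ⊗ 1) ν eᵢ`, and the slice along `eⱼ` turns
  -- `K ⊗ 1` into `κ j`.
  rw [← eq_sub_iff_add_eq'] at hab
  rw [hab, map_sub, map_smul, slice_tensorB hK (he j), ← sub_smul, ← Complex.ofReal_sub] at h4
  exact h4

variable {ι : Type*} [Fintype ι] {K : 𝒦 →L[ℂ] 𝒦} {Y : 𝔥 →ₗ.[ℂ] 𝔥} {ν : 𝒦 →L[ℂ] HTensor 𝒦 𝔥}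

namespace EigenData

theorem inner_h_eq_zero (d : EigenData K Y ν ι) (hY : IsSelfAdjoint Y) {i j l m : ι}
    (hne : d.κ i - d.κ j ≠ d.κ m - d.κ l) : ⟪d.h j i, d.h l m⟫_ℂ = 0 := by
  have h := (adjPair_of_isSelfAdjoint hY).inner_eq _ (d.mem_graph j i) _ (d.mem_graph l m)
  simp only [inner_smul_left, inner_smul_right, Complex.conj_ofReal] at h
  rw [← sub_eq_zero, ← sub_mul, ← Complex.ofReal_sub] at h
  refine (mul_eq_zero.mp h).resolve_left ?_
  exact_mod_cast sub_ne_zero.mpr hne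

theorem adjoint_ν_tmulH (d : EigenData K Y ν ι) (x : 𝒦) (y : 𝔥) :
    ν.adjoint (tmulH x y) = ∑ s, ∑ r, (⟪d.e r, x⟫_ℂ * ⟪d.h r s, y⟫_ℂ) • d.e s := by
  rw [← d.e.sum_repr' (ν.adjoint (tmulH x y))]
  refine Finset.sum_congr rfl fun s _ => ?_
  rw [ContinuousLinearMap.adjoint_inner_right, d.apply_ν, sum_inner, Finset.sum_smul]
  simp only [inner_tmulH]

theorem inner_adjoint_ν_tmulH (d : EigenData K Y ν ι) (s : ι) (x : 𝒦) (y : 𝔥) :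
    ⟪d.e s, ν.adjoint (tmulH x y)⟫_ℂ = ∑ r, ⟪d.e r, x⟫_ℂ * ⟪d.h r s, y⟫_ℂ := by
  rw [ContinuousLinearMap.adjoint_inner_right, d.apply_ν, sum_inner]
  simp only [inner_tmulH]

/-- The condition `Tr_𝔥 ν A ν* = ν* (A ⊗ e^{-βY}) ν` in matrix elements. -/
def Balanced (d : EigenData K Y ν ι) (β : ℝ) : Prop :=
  ∀ a b p q, ⟪d.h q b, d.h p a⟫_ℂ =
    Complex.exp (-(β : ℂ) * (d.κ q - d.κ b : ℝ)) * ⟪d.h a p, d.h b q⟫_ℂ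

end EigenData

theorem ofB_eq_iff_basis {F : Type*} [NormedAddCommGroup F] [InnerProductSpace ℂ F]
    (e : OrthonormalBasis ι ℂ 𝒦) {f : 𝒦 →ₗ.[ℂ] F} {y : ι → F}
    (hy : ∀ i, (e i, y i) ∈ f.graph) {T : 𝒦 →L[ℂ] F} : ofB T = f ↔ ∀ i, T (e i) = y i := by
  rw [ofB_eq_iff]
  constructor
  · exact fun h i => LinearPMap.mem_graph_snd_inj _ (h (e i)) (hy i) rfl
  · intro h x
    convert! sum_smul_mem_graph (fun i => ⟪e i, x⟫_ℂ) hy using 1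
    conv_lhs => rw [← e.sum_repr' x]
    simp only [map_sum, map_smul, h]

theorem clm_ext_inner {F : Type*} [NormedAddCommGroup F] [NormedSpace ℂ F]
    (e : OrthonormalBasis ι ℂ 𝒦) {S T : 𝒦 →L[ℂ] F} (h : ∀ i, S (e i) = T (e i)) : S = T := by
  ext x
  rw [← e.sum_repr' x]
  simp only [map_sum, map_smul, h]

theorem eq_iff_inner_left (e : OrthonormalBasis ι ℂ 𝒦) {x y : 𝒦} :
    x = y ↔ ∀ p, ⟪e p, x⟫_ℂ = ⟪e p, y⟫_ℂ := by
  refine ⟨fun h p => h ▸ rfl, fun h => ?_⟩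
  rw [← e.sum_repr' x, ← e.sum_repr' y]
  simp only [h]

/-! ### The partial trace -/

theorem adjoint_tensorKet_tmulH {H : Type*} [NormedAddCommGroup H] [InnerProductSpace ℂ H]
    (y z : H) (x : 𝒦) : (tensorKet 𝒦 y).adjoint (tmulH x z) = ⟪y, z⟫_ℂ • x := by
  refine ext_inner_left ℂ fun v => ?_
  rw [ContinuousLinearMap.adjoint_inner_right, tensorKet_apply, inner_tmulH, inner_smul_right,
    mul_comm]

/-- The operator `|x)(y|`. -/
noncomputable def ketBra (x y : 𝒦) : 𝒦 →L[ℂ] 𝒦 := InnerProductSpace.rankOne ℂ x y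

theorem ketBra_apply (x y z : 𝒦) : ketBra x y z = ⟪y, z⟫_ℂ • x :=
  InnerProductSpace.rankOne_apply x y z

theorem adjoint_ketBra (x y : 𝒦) : (ketBra x y).adjoint = ketBra y x :=
  InnerProductSpace.adjoint_rankOne x y

namespace EigenData

theorem adjoint_tensorKet_comp_ν (d : EigenData K Y ν ι) (b : 𝔥) :
    (tensorKet 𝒦 b).adjoint ∘L ν = ∑ i, ∑ k, ⟪b, d.h k i⟫_ℂ • ketBra (d.e k) (d.e i) := by
  classical
  refine clm_ext_inner d.e fun m => ?_
  simp [d.apply_ν, adjoint_tensorKet_tmulH, ketBra_apply, sum_apply, smul_apply,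
    orthonormal_iff_ite.mp d.e.orthonormal]

theorem adjoint_ν_comp_tensorKet (d : EigenData K Y ν ι) (b : 𝔥) :
    ν.adjoint ∘L tensorKet 𝒦 b = ∑ i, ∑ k, ⟪d.h k i, b⟫_ℂ • ketBra (d.e i) (d.e k) := by
  rw [← ContinuousLinearMap.adjoint_adjoint (ν.adjoint ∘L tensorKet 𝒦 b),
    ContinuousLinearMap.adjoint_comp, ContinuousLinearMap.adjoint_adjoint,
    d.adjoint_tensorKet_comp_ν]
  simp [map_smulₛₗ, adjoint_ketBra]

theorem partialTrace_eq (d : EigenData K Y ν ι) (A : 𝒦 →L[ℂ] 𝒦) :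
    partialTrace (ν ∘L A ∘L ν.adjoint) = ∑ m, ∑ l, ∑ i, ∑ k,
      ⟪d.h l m, d.h k i⟫_ℂ • (ketBra (d.e k) (d.e i) ∘L A ∘L ketBra (d.e m) (d.e l)) := by
  refine HasSum.tsum_eq ?_
  have key : ∀ b : 𝔥, (tensorKet 𝒦 b).adjoint ∘L (ν ∘L A ∘L ν.adjoint) ∘L tensorKet 𝒦 b =
      ∑ m, ∑ l, ∑ i, ∑ k, (⟪d.h l m, b⟫_ℂ * ⟪b, d.h k i⟫_ℂ) •
        (ketBra (d.e k) (d.e i) ∘L A ∘L ketBra (d.e m) (d.e l)) := by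
    intro b
    have : (tensorKet 𝒦 b).adjoint ∘L (ν ∘L A ∘L ν.adjoint) ∘L tensorKet 𝒦 b =
      ((tensorKet 𝒦 b).adjoint ∘L ν) ∘L A ∘L (ν.adjoint ∘L tensorKet 𝒦 b) := rfl
    rw [this, d.adjoint_tensorKet_comp_ν, d.adjoint_ν_comp_tensorKet]
    ext x
    simp only [ContinuousLinearMap.comp_apply, sum_apply, smul_apply, map_sum, map_smul,
      Finset.smul_sum, smul_smul]
  simp only [key]
  -- Only finitely many matrix units occur, so the trace is a finite combination of Parseval sums.
  -- This also settles its convergence.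
  exact hasSum_sum fun m _ => hasSum_sum fun l _ => hasSum_sum fun i _ => hasSum_sum fun k _ =>
    ((basisOf 𝔥).hasSum_inner_mul_inner _ _).smul_const _

theorem inner_partialTrace (d : EigenData K Y ν ι) (A : 𝒦 →L[ℂ] 𝒦) (p q : ι) :
    ⟪d.e p, partialTrace (ν ∘L A ∘L ν.adjoint) (d.e q)⟫_ℂ =
      ∑ i, ∑ m, ⟪d.e i, A (d.e m)⟫_ℂ * ⟪d.h q m, d.h p i⟫_ℂ := by
  classical
  rw [d.partialTrace_eq]
  simp only [sum_apply, smul_apply, ContinuousLinearMap.comp_apply, ketBra_apply, map_smul,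
    inner_sum, inner_smul_right, orthonormal_iff_ite.mp d.e.orthonormal, mul_ite, ite_mul,
    mul_one, mul_zero, one_mul, zero_mul, Finset.sum_ite_eq, Finset.sum_ite_eq', Finset.mem_univ,
    if_true, Finset.sum_const_zero, Finset.sum_ite_irrel, ite_self, mul_comm]
  exact Finset.sum_comm

theorem mem_graph_traceCondition (d : EigenData K Y ν ι) (hY : IsSelfAdjoint Y) (β : ℝ)
    (A : 𝒦 →L[ℂ] 𝒦) (q : ι) :
    (d.e q, ∑ l, Complex.exp (-(β : ℂ) * (d.κ q - d.κ l : ℝ)) •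
      ν.adjoint (tmulH (A (d.e l)) (d.h l q))) ∈
      (opMul (ofB ν.adjoint) (opMul (tensorOp (ofB A) (expOp (-(β : ℂ)) Y)) (ofB ν))).graph := by
  have hsymm := (adjPair_of_isSelfAdjoint hY).inner_eq
  refine mem_graph_opMul.mpr ⟨∑ l, Complex.exp (-(β : ℂ) * (d.κ q - d.κ l : ℝ)) •
    tmulH (A (d.e l)) (d.h l q), mem_graph_opMul.mpr ⟨ν (d.e q), mem_graph_ofB.mpr rfl, ?_⟩,
    mem_graph_ofB.mpr (by simp only [map_sum, map_smul])⟩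
  rw [d.apply_ν]
  have h := sum_smul_mem_graph (f := tensorOp (ofB A) (expOp (-(β : ℂ)) Y)) (fun _ : ι => (1 : ℂ))
    (fun l => mem_graph_tensorOp (adjPair_ofB A)
      (adjPair_expOp hsymm (-(β : ℂ)) (-(β : ℂ)) (by simp))
      (mem_graph_ofB.mpr (rfl : A (d.e l) = _))
      (mem_graph_expOp_of_eigen hsymm (-(β : ℂ)) (d.mem_graph l q)))
  simpa only [one_smul, tmulH_smul] using h

theorem traceCondition_iff (d : EigenData K Y ν ι) (hY : IsSelfAdjoint Y) (β : ℝ) :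
    TraceCondition β Y ν ↔ d.Balanced β := by
  classical
  have key : TraceCondition β Y ν ↔ ∀ (A : 𝒦 →L[ℂ] 𝒦) (q p : ι),
      ∑ i, ∑ m, ⟪d.e i, A (d.e m)⟫_ℂ * ⟪d.h q m, d.h p i⟫_ℂ =
      ∑ i, ∑ m, ⟪d.e i, A (d.e m)⟫_ℂ *
        (Complex.exp (-(β : ℂ) * (d.κ q - d.κ m : ℝ)) * ⟪d.h i p, d.h m q⟫_ℂ) := by
    refine forall_congr' fun A => ?_
    rw [ofB_eq_iff_basis d.e (d.mem_graph_traceCondition hY β A)]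
    refine forall_congr' fun q => ?_
    rw [eq_iff_inner_left d.e]
    refine forall_congr' fun p => ?_
    rw [d.inner_partialTrace, inner_sum]
    simp only [inner_smul_right, d.inner_adjoint_ν_tmulH, Finset.mul_sum]
    conv_rhs => rhs; rw [Finset.sum_comm]
    simp only [mul_left_comm]
  rw [key]
  constructor
  · intro h a b p q
    -- The matrix unit `|e_a)(e_b|` isolates the single term `i = a`, `m = b`.
    have := h (ketBra (d.e a) (d.e b)) q p
    simpa only [ketBra_apply, inner_smul_right, orthonormal_iff_ite.mp d.e.orthonormal, mul_ite,
      ite_mul, mul_one, mul_zero, one_mul, zero_mul, Finset.sum_ite_eq, Finset.sum_ite_eq',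
      Finset.mem_univ, if_true, Finset.sum_const_zero, Finset.sum_ite_irrel, ite_self] using this
  · intro h A q p
    refine Finset.sum_congr rfl fun i _ => Finset.sum_congr rfl fun m _ => ?_
    rw [h i m p q]

end EigenData

end EigenData

end QuantumNoise
namespace QuantumNoise


/-! ### Two-point functions of field operators -/

section FieldOp

variable {𝒦 H : Type*} [NormedAddCommGroup 𝒦] [InnerProductSpace ℂ 𝒦] [CompleteSpace 𝒦]
  [NormedAddCommGroup H] [InnerProductSpace ℂ H] [CompleteSpace H]
  {ι : Type*} [Fintype ι]

/-- The field operator `(D ⊗ 1) (a*(V) + a(V)) (D' ⊗ 1)`. -/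
noncomputable def fieldOp (V : 𝒦 →L[ℂ] HTensor 𝒦 H) (D D' : 𝒦 →L[ℂ] 𝒦) :
    HTensor 𝒦 (Fock H) →ₗ.[ℂ] HTensor 𝒦 (Fock H) :=
  opMul (ofB (tensorB D (ContinuousLinearMap.id ℂ _)))
    (opMul (creat V + annih V) (ofB (tensorB D' (ContinuousLinearMap.id ℂ _))))

theorem mem_graph_fieldOp {V : 𝒦 →L[ℂ] HTensor 𝒦 H} {D D' : 𝒦 →L[ℂ] 𝒦} {x : 𝒦} {s : Fock H}
    {a b c : HTensor 𝒦 (Fock H)} (ha : (tmulH (D' x) s, a) ∈ (creat V).graph)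
    (hb : (tmulH (D' x) s, b) ∈ (annih V).graph)
    (hc : tensorB D (ContinuousLinearMap.id ℂ _) (a + b) = c) :
    (tmulH x s, c) ∈ (fieldOp V D D').graph :=
  mem_graph_opMul.mpr ⟨a + b, mem_graph_opMul.mpr ⟨tmulH (D' x) s,
    mem_graph_ofB.mpr (tensorB_tmulH _ _ _ _), mem_graph_add.mpr ⟨a, b, ha, hb, rfl⟩⟩,
    mem_graph_ofB.mpr hc⟩

/-- The span of the two particle vectors `x ⊗ S(w r s ⊗ w' j i)`. -/
noncomputable def twoParticle (𝒦 : Type*) [NormedAddCommGroup 𝒦] [InnerProductSpace ℂ 𝒦]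
    (w w' : ι → ι → H) : Submodule ℂ (HTensor 𝒦 (Fock H)) :=
  Submodule.span ℂ {y | ∃ (x : 𝒦) (r s j i : ι),
    y = tmulH x (symVec 2 (Fin.cons (w r s) fun _ => w' j i : Fin 2 → H))}

theorem cons_fin_one {α : Type*} (a : α) : (Fin.cons a Fin.elim0 : Fin 1 → α) = fun _ => a := by
  funext k
  rw [Fin.fin_one_eq_zero k]
  rfl

theorem adjoint_tensorKet_vacuum (x : 𝒦) :
    (tensorKet 𝒦 (vacuum H)).adjoint (tmulH x (vacuum H)) = x := by
  rw [adjoint_tensorKet_tmulH, inner_vacuum_vacuum, one_smul]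

theorem adjoint_tensorKet_twoParticle {w w' : ι → ι → H} {y : HTensor 𝒦 (Fock H)}
    (hy : y ∈ twoParticle 𝒦 w w') : (tensorKet 𝒦 (vacuum H)).adjoint y = 0 := by
  refine (Submodule.span_le (p := (tensorKet 𝒦 (vacuum H)).adjoint.ker)).mpr ?_ hy
  rintro _ ⟨x, r, s, j, i, rfl⟩
  change (tensorKet 𝒦 (vacuum H)).adjoint _ = 0
  rw [adjoint_tensorKet_tmulH, vacuum, inner_symVec_of_ne (by norm_num), zero_smul]

/-! ### Field operators on vacuum and one-particle vectors -/

section Creation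

variable [FiniteDimensional ℂ 𝒦] (e : OrthonormalBasis ι ℂ 𝒦) {V : 𝒦 →L[ℂ] HTensor 𝒦 H}
  {w : ι → ι → H} (hw : ∀ j i, slice (e j) (V (e i)) = w j i)
include hw

theorem mem_graph_creat_of_slice (x : 𝒦) {n : ℕ} (v : Fin n → H) :
    (tmulH x (symVec n v), ∑ i, ⟪e i, x⟫_ℂ • (√((n : ℝ) + 1) : ℂ) • ∑ j, tmulH (e j)
      (symVec (n + 1) (Fin.cons (w j i) v : Fin (n + 1) → H))) ∈ (creat V).graph := by
  have h := sum_smul_mem_graph (fun i => ⟪e i, x⟫_ℂ) fun i => mem_graph_creat e V (e i) v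
  simp only [hw, ← smul_tmulH, ← sum_tmulH, e.sum_repr' x] at h
  exact h

theorem mem_graph_fieldOp_vacuum (D D' : 𝒦 →L[ℂ] 𝒦) (x : 𝒦) :
    (tmulH x (vacuum H), ∑ i, ⟪e i, D' x⟫_ℂ • ∑ j, tmulH (D (e j)) (symVec 1 fun _ => w j i)) ∈
      (fieldOp V D D').graph := by
  refine mem_graph_fieldOp (mem_graph_creat_of_slice e hw (D' x) Fin.elim0)
    (mem_graph_annih_vacuum V _) ?_
  simp [cons_fin_one, tensorB_tmulH]

theorem mem_graph_fieldOp_one (w' : ι → ι → H) (D D' : 𝒦 →L[ℂ] 𝒦) (x : 𝒦) (j i : ι) :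
    ∃ y ∈ twoParticle 𝒦 w w', (tmulH x (symVec 1 fun _ => w' j i),
      y + tmulH (D (V.adjoint (tmulH (D' x) (w' j i)))) (vacuum H)) ∈ (fieldOp V D D').graph := by
  have h1 := mem_graph_creat_of_slice e hw (D' x) fun _ : Fin 1 => w' j i
  have h2 := mem_graph_annih_one V (D' x) (w' j i)
  rw [cons_fin_one] at h2
  refine ⟨_, ?_, mem_graph_fieldOp h1 h2 ((map_add _ _ _).trans
    (congrArg₂ (· + ·) rfl (tensorB_tmulH _ _ _ _)))⟩
  simp only [map_sum, map_smul, tensorB_tmulH]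
  exact Submodule.sum_mem _ fun s _ => Submodule.smul_mem _ _ (Submodule.smul_mem _ _
    (Submodule.sum_mem _ fun r _ => Submodule.subset_span ⟨_, r, s, j, i, rfl⟩))

end Creation

/-! ### Time evolution and vacuum expectations of products -/

section Evolution

variable (e : OrthonormalBasis ι ℂ 𝒦) {K : 𝒦 →L[ℂ] 𝒦} (hK : IsSelfAdjoint K) {κ : ι → ℝ}
  (he : ∀ i, K (e i) = (κ i : ℂ) • e i) {h : H →ₗ.[ℂ] H}
  (hh : AdjPair (h.graph : Set (H × H)) (h.graph : Set (H × H)))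
include hK he hh

theorem mem_graph_exp_vacuum (z : ℂ) (x : 𝒦) :
    (tmulH x (vacuum H), tmulH (NormedSpace.exp (z • K) x) (vacuum H)) ∈
      (expOp z (energyOp K h)).graph := by
  have h := mem_graph_exp_energyOp hK hh e he z x
    (v := Fin.elim0) (c := fun _ => 0) (fun i => i.elim0)
  simpa only [Fin.sum_univ_zero, mul_zero, Complex.exp_zero, one_smul, vacuum] using h

theorem mem_graph_exp_one (z : ℂ) (x : 𝒦) {b : H} {c : ℂ} (hb : (b, c • b) ∈ h.graph) :
    (tmulH x (symVec 1 fun _ => b), Complex.exp (z * c) • tmulH (NormedSpace.exp (z • K) x)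
      (symVec 1 fun _ => b)) ∈ (expOp z (energyOp K h)).graph := by
  have h := mem_graph_exp_energyOp hK hh e he z x (v := fun _ : Fin 1 => b) (c := fun _ => c)
    (fun _ => hb)
  simpa only [Fin.sum_univ_one] using h

/-- The two-particle part does not contribute to the expectation, but it must lie in the domain of
`e^{zE}` for the product to be defined, and must stay orthogonal to the vacuum sector. -/
theorem exp_twoParticle {w w' : ι → ι → H} {c : ι → ι → ℂ}
    (hw : ∀ j i, (w j i, c j i • w j i) ∈ h.graph)
    (hw' : ∀ j i, (w' j i, c j i • w' j i) ∈ h.graph) (z : ℂ) {y : HTensor 𝒦 (Fock H)}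
    (hy : y ∈ twoParticle 𝒦 w w') :
    ∃ y' ∈ twoParticle 𝒦 w w', (y, y') ∈ (expOp z (energyOp K h)).graph := by
  induction hy using Submodule.span_induction with
  | zero => exact ⟨0, zero_mem _, zero_mem _⟩
  | add a b _ _ ha hb =>
    obtain ⟨a', ha', ha⟩ := ha
    obtain ⟨b', hb', hb⟩ := hb
    exact ⟨a' + b', add_mem ha' hb', add_mem ha hb⟩
  | smul c a _ ha =>
    obtain ⟨a', ha', ha⟩ := ha
    exact ⟨c • a', Submodule.smul_mem _ c ha', Submodule.smul_mem _ c ha⟩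
  | mem a ha =>
    obtain ⟨x, r, s, j, i, rfl⟩ := ha
    have h := mem_graph_exp_energyOp hK hh e he z x
      (v := (Fin.cons (w r s) fun _ => w' j i : Fin 2 → H))
      (c := (Fin.cons (c r s) fun _ => c j i : Fin 2 → ℂ))
      (fun k => by refine Fin.cases (hw r s) (fun k => hw' j i) k)
    exact ⟨_, Submodule.smul_mem _ _ (Submodule.subset_span ⟨_, r, s, j, i, rfl⟩), h⟩

variable [FiniteDimensional ℂ 𝒦] {V₁ V₂ : 𝒦 →L[ℂ] HTensor 𝒦 H} {w₁ w₂ : ι → ι → H}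
  {c : ι → ι → ℂ} (hw₁ : ∀ j i, slice (e j) (V₁ (e i)) = w₁ j i)
  (hw₂ : ∀ j i, slice (e j) (V₂ (e i)) = w₂ j i)
  (hc₁ : ∀ j i, (w₁ j i, c j i • w₁ j i) ∈ h.graph)
  (hc₂ : ∀ j i, (w₂ j i, c j i • w₂ j i) ∈ h.graph)
include hw₁ hw₂ hc₁

include hc₂ in
theorem mem_graph_sigma_mul (D₁ D₁' D₂ D₂' : 𝒦 →L[ℂ] 𝒦) (t : ℂ) (m : ι) :
    (e m, ∑ i, ⟪e i, D₂' (e m)⟫_ℂ • ∑ j, Complex.exp (-(Complex.I * t) * c j i) •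
      NormedSpace.exp ((Complex.I * t) • K) (D₁ (V₁.adjoint (tmulH
        (D₁' (NormedSpace.exp (-(Complex.I * t) • K) (D₂ (e j)))) (w₂ j i))))) ∈
      (opMul (ofB (tensorKet 𝒦 (vacuum H)).adjoint)
        (opMul (opMul (sigma (energyOp K h) t (fieldOp V₁ D₁ D₁'))
          (fieldOp V₂ D₂ D₂')) (ofB (tensorKet 𝒦 (vacuum H))))).graph := by
  have key : ∀ i j, ∃ y, (tmulH (D₂ (e j)) (symVec 1 fun _ => w₂ j i), y) ∈
      (sigma (energyOp K h) t (fieldOp V₁ D₁ D₁')).graph ∧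
      (tensorKet 𝒦 (vacuum H)).adjoint y = Complex.exp (-(Complex.I * t) * c j i) •
      NormedSpace.exp ((Complex.I * t) • K) (D₁ (V₁.adjoint (tmulH
        (D₁' (NormedSpace.exp (-(Complex.I * t) • K) (D₂ (e j)))) (w₂ j i)))) := by
    intro i j
    obtain ⟨u, hu, hug⟩ := mem_graph_fieldOp_one e hw₁ w₂ D₁ D₁'
      (NormedSpace.exp (-(Complex.I * t) • K) (D₂ (e j))) j i
    obtain ⟨u', hu', hu'g⟩ := exp_twoParticle e hK he hh hc₁ hc₂ (Complex.I * t) hu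
    refine ⟨_, mem_graph_opMul.mpr ⟨_, mem_graph_opMul.mpr ⟨_,
      mem_graph_exp_one e hK he hh (-(Complex.I * t)) (D₂ (e j)) (hc₂ j i),
      Submodule.smul_mem _ _ hug⟩, Submodule.smul_mem _ _
        (Submodule.add_mem _ hu'g (mem_graph_exp_vacuum e hK he hh (Complex.I * t) _))⟩, ?_⟩
    rw [map_smul, Prod.snd_add, map_add, adjoint_tensorKet_twoParticle hu',
      adjoint_tensorKet_vacuum, zero_add]
  choose y hy hyI using key
  refine mem_graph_opMul.mpr ⟨∑ i, ⟪e i, D₂' (e m)⟫_ℂ • ∑ j, y i j,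
    mem_graph_opMul.mpr ⟨tmulH (e m) (vacuum _), mem_graph_ofB.mpr rfl,
      mem_graph_opMul.mpr ⟨_, mem_graph_fieldOp_vacuum e hw₂ D₂ D₂' (e m), ?_⟩⟩,
    mem_graph_ofB.mpr ?_⟩
  · refine sum_smul_mem_graph _ fun i => ?_
    simpa only [one_smul] using sum_smul_mem_graph (fun _ => 1) fun j => hy i j
  · simp only [map_sum, map_smul, hyI]

/-- In this order no evolution follows the second field operator, so the two-particle part is
projected away directly. -/
theorem mem_graph_mul_sigma (D₁ D₁' D₂ D₂' : 𝒦 →L[ℂ] 𝒦) (t : ℂ) (m : ι) :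
    (e m, ∑ i, ⟪e i, D₁' (NormedSpace.exp (-(Complex.I * t) • K) (e m))⟫_ℂ • ∑ j,
      Complex.exp (Complex.I * t * c j i) • D₂ (V₂.adjoint (tmulH
        (D₂' (NormedSpace.exp ((Complex.I * t) • K) (D₁ (e j)))) (w₁ j i)))) ∈
      (opMul (ofB (tensorKet 𝒦 (vacuum H)).adjoint)
        (opMul (opMul (fieldOp V₂ D₂ D₂') (sigma (energyOp K h) t (fieldOp V₁ D₁ D₁')))
          (ofB (tensorKet 𝒦 (vacuum H))))).graph := by
  have key : ∀ i j, ∃ y, (Complex.exp (Complex.I * t * c j i) •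
        tmulH (NormedSpace.exp ((Complex.I * t) • K) (D₁ (e j))) (symVec 1 fun _ => w₁ j i), y) ∈
      (fieldOp V₂ D₂ D₂').graph ∧
      (tensorKet 𝒦 (vacuum H)).adjoint y = Complex.exp (Complex.I * t * c j i) •
        D₂ (V₂.adjoint (tmulH
          (D₂' (NormedSpace.exp ((Complex.I * t) • K) (D₁ (e j)))) (w₁ j i))) := by
    intro i j
    obtain ⟨u, hu, hug⟩ := mem_graph_fieldOp_one e hw₂ w₁ D₂ D₂'
      (NormedSpace.exp ((Complex.I * t) • K) (D₁ (e j))) j i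
    refine ⟨_, Submodule.smul_mem _ _ hug, ?_⟩
    rw [map_smul, map_add, adjoint_tensorKet_twoParticle hu, adjoint_tensorKet_vacuum, zero_add]
  choose y hy hyI using key
  set x := NormedSpace.exp (-(Complex.I * t) • K) (e m)
  refine mem_graph_opMul.mpr ⟨∑ i, ⟪e i, D₁' x⟫_ℂ • ∑ j, y i j,
    mem_graph_opMul.mpr ⟨tmulH (e m) (vacuum _), mem_graph_ofB.mpr rfl,
      mem_graph_opMul.mpr ⟨∑ i, ⟪e i, D₁' x⟫_ℂ • ∑ j, Complex.exp (Complex.I * t * c j i) •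
        tmulH (NormedSpace.exp ((Complex.I * t) • K) (D₁ (e j))) (symVec 1 fun _ => w₁ j i),
        mem_graph_opMul.mpr ⟨_, mem_graph_opMul.mpr ⟨_, mem_graph_exp_vacuum e hK he hh _ _,
          mem_graph_fieldOp_vacuum e hw₁ D₁ D₁' _⟩, ?_⟩, ?_⟩⟩,
    mem_graph_ofB.mpr ?_⟩
  · refine sum_smul_mem_graph _ fun i => ?_
    simpa only [one_smul] using sum_smul_mem_graph (fun _ => 1)
      fun j => mem_graph_exp_one e hK he hh (Complex.I * t) (D₁ (e j)) (hc₁ j i)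
  · refine sum_smul_mem_graph _ fun i => ?_
    simpa only [one_smul] using sum_smul_mem_graph (fun _ => 1) fun j => hy i j
  · simp only [map_sum, map_smul, hyI]

end Evolution

end FieldOp

end QuantumNoise
namespace QuantumNoise


/-! ### The KMS condition in matrix elements -/

section KMS

theorem exp_smul_exp_smul {𝒦 : Type*} [NormedAddCommGroup 𝒦] [NormedSpace ℂ 𝒦]
    [CompleteSpace 𝒦] (K : 𝒦 →L[ℂ] 𝒦) (a b : ℂ) (v : 𝒦) :
    NormedSpace.exp (a • K) (NormedSpace.exp (b • K) v) = NormedSpace.exp ((a + b) • K) v := by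
  have h : NormedSpace.exp ((a + b) • K) = NormedSpace.exp (a • K) * NormedSpace.exp (b • K) := by
    let _ : NormedAlgebra ℚ (𝒦 →L[ℂ] 𝒦) := NormedAlgebra.restrictScalars ℚ ℂ _
    rw [add_smul]
    exact NormedSpace.exp_add_of_commute (((Commute.refl K).smul_left a).smul_right b)
  rw [h]
  rfl

theorem sum_four_reverse {ι M : Type*} [Fintype ι] [AddCommMonoid M] (F : ι → ι → ι → ι → M) :
    ∑ i, ∑ j, ∑ s, ∑ r, F i j s r = ∑ r, ∑ s, ∑ j, ∑ i, F i j s r := by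
  have h1 : ∑ i, ∑ j, ∑ s, ∑ r, F i j s r = ∑ x : ι × ι × ι × ι, F x.1 x.2.1 x.2.2.1 x.2.2.2 := by
    simp only [Fintype.sum_prod_type]
  have h2 : ∑ r, ∑ s, ∑ j, ∑ i, F i j s r = ∑ x : ι × ι × ι × ι, F x.2.2.2 x.2.2.1 x.2.1 x.1 := by
    simp only [Fintype.sum_prod_type]
  rw [h1, h2]
  exact Fintype.sum_equiv
    { toFun := fun x => (x.2.2.2, x.2.2.1, x.2.1, x.1)
      invFun := fun x => (x.2.2.2, x.2.2.1, x.2.1, x.1)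
      left_inv := fun _ => rfl
      right_inv := fun _ => rfl } _ _ fun _ => rfl

variable {𝒦 𝔥 : Type*} [NormedAddCommGroup 𝒦] [InnerProductSpace ℂ 𝒦] [CompleteSpace 𝒦]
  [NormedAddCommGroup 𝔥] [InnerProductSpace ℂ 𝔥] [CompleteSpace 𝔥]
  {ι : Type*} [Fintype ι] {K : 𝒦 →L[ℂ] 𝒦} {Y : 𝔥 →ₗ.[ℂ] 𝔥} {ν : 𝒦 →L[ℂ] HTensor 𝒦 𝔥}

theorem tr_eq_sum_inner (e : OrthonormalBasis ι ℂ 𝒦) (A : 𝒦 →L[ℂ] 𝒦) :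
    tr A = ∑ i, ⟪e i, A (e i)⟫_ℂ :=
  LinearMap.trace_eq_sum_inner _ e

theorem exists_clm_of_basis {F : Type*} [NormedAddCommGroup F] [InnerProductSpace ℂ F]
    (e : OrthonormalBasis ι ℂ 𝒦) (y : ι → F) : ∃ T : 𝒦 →L[ℂ] F, ∀ i, T (e i) = y i := by
  classical
  refine ⟨∑ i, (innerSL ℂ (e i)).smulRight (y i), fun i => ?_⟩
  simp [sum_apply, orthonormal_iff_ite.mp e.orthonormal]

namespace EigenData

theorem inner_exp (d : EigenData K Y ν ι) (z : ℂ) (m : ι) (v : 𝒦) :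
    ⟪d.e m, NormedSpace.exp (z • K) v⟫_ℂ = Complex.exp (z * d.κ m) * ⟪d.e m, v⟫_ℂ := by
  classical
  conv_lhs => rw [← d.e.sum_repr' v]
  simp [map_sum, exp_apply_eigen (d.apply_e _),
    orthonormal_iff_ite.mp d.e.orthonormal, mul_comm]

theorem tr_gibbs_mul (d : EigenData K Y ν ι) (β : ℝ) (T : 𝒦 →L[ℂ] 𝒦) :
    tr (gibbs β K * T) = ∑ m, Complex.exp (-(β : ℂ) * d.κ m) * ⟪d.e m, T (d.e m)⟫_ℂ := by
  rw [tr_eq_sum_inner d.e]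
  exact Finset.sum_congr rfl fun m _ => d.inner_exp _ m _

theorem tr_gibbs (d : EigenData K Y ν ι) (β : ℝ) :
    tr (gibbs β K) = ((∑ m, Real.exp (-β * d.κ m) : ℝ) : ℂ) := by
  have h := d.tr_gibbs_mul β 1
  rw [mul_one] at h
  rw [h]
  push_cast
  refine Finset.sum_congr rfl fun m _ => ?_
  simp [inner_self_eq_norm_sq_to_K]

theorem tr_gibbs_ne_zero [Nonempty ι] (d : EigenData K Y ν ι) (β : ℝ) : tr (gibbs β K) ≠ 0 := by
  rw [d.tr_gibbs]
  have : (0 : ℝ) < ∑ m, Real.exp (-β * d.κ m) :=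
    Finset.sum_pos (fun m _ => Real.exp_pos _) Finset.univ_nonempty
  exact_mod_cast this.ne'

theorem hasExpectation_iff (d : EigenData K Y ν ι) (β : ℝ)
    {C : NoiseSpace 𝒦 𝔥 →ₗ.[ℂ] NoiseSpace 𝒦 𝔥} {y : ι → 𝒦}
    (hy : ∀ m, (d.e m, y m) ∈ (opMul (ofB (tensorKet 𝒦 (vacuum (HTensor 𝔥 L2R))).adjoint)
      (opMul C (ofB (tensorKet 𝒦 (vacuum (HTensor 𝔥 L2R)))))).graph) {c : ℂ} :
    HasExpectation β K C c ↔
      c = (∑ m, Complex.exp (-(β : ℂ) * d.κ m) * ⟪d.e m, y m⟫_ℂ) / tr (gibbs β K) := by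
  constructor
  · rintro ⟨T, hT, rfl⟩
    rw [d.tr_gibbs_mul]
    simp only [(ofB_eq_iff_basis d.e hy).mp hT]
  · rintro rfl
    obtain ⟨T, hT⟩ := exists_clm_of_basis d.e y
    refine ⟨T, (ofB_eq_iff_basis d.e hy).mpr hT, ?_⟩
    rw [d.tr_gibbs_mul]
    simp only [hT]

/-- The two-point sum
`∑ exp (z (κᵢ - κⱼ)) (h r s|h j i) (eᵢ|P eₛ) (eᵣ|Q eⱼ)`. -/
noncomputable def corr (d : EigenData K Y ν ι) (z : ℂ) (P Q : 𝒦 →L[ℂ] 𝒦) : ℂ :=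
  ∑ i, ∑ j, ∑ s, ∑ r, Complex.exp (z * (d.κ i - d.κ j : ℝ)) * ⟪d.h r s, d.h j i⟫_ℂ *
    ⟪d.e i, P (d.e s)⟫_ℂ * ⟪d.e r, Q (d.e j)⟫_ℂ

/-- This serves both operator orders. Cyclicity of the trace gathers `A`, the Gibbs weight and `B`
into the one operator `P`; `c` carries the inner product of the test functions. -/
theorem sum_gibbs_eq_corr (d : EigenData K Y ν ι) (β : ℝ) (z c : ℂ) (A B P Q : 𝒦 →L[ℂ] 𝒦)
    (hP : ∀ v, A (gibbs β K (B v)) = P v) :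
    ∑ m, Complex.exp (-(β : ℂ) * d.κ m) * ⟪d.e m, ∑ i, ⟪d.e i, A (d.e m)⟫_ℂ • ∑ j,
      Complex.exp (z * (d.κ i - d.κ j : ℝ)) •
        B (c • ν.adjoint (tmulH (Q (d.e j)) (d.h j i)))⟫_ℂ = c * d.corr z P Q := by
  have hPs : ∀ i s, ⟪d.e i, P (d.e s)⟫_ℂ = ∑ m, Complex.exp (-(β : ℂ) * d.κ m) *
      ⟪d.e m, B (d.e s)⟫_ℂ * ⟪d.e i, A (d.e m)⟫_ℂ := by
    intro i s
    rw [← hP, ← d.e.sum_repr' (gibbs β K (B (d.e s)))]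
    simp only [map_sum, map_smul, inner_sum, inner_smul_right, gibbs, d.inner_exp]
  simp only [corr, hPs, d.adjoint_ν_tmulH, map_sum, map_smul, inner_sum, inner_smul_right,
    Finset.mul_sum, Finset.sum_mul]
  rw [Finset.sum_comm]
  refine Finset.sum_congr rfl fun i _ => ?_
  rw [Finset.sum_comm]
  refine Finset.sum_congr rfl fun j _ => ?_
  rw [Finset.sum_comm]
  refine Finset.sum_congr rfl fun s _ => ?_
  rw [Finset.sum_comm]
  refine Finset.sum_congr rfl fun r _ => Finset.sum_congr rfl fun m _ => ?_
  ring

theorem slice_nuKet (d : EigenData K Y ν ι) (f : L2R) (j i : ι) :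
    slice (d.e j) (nuKet ν f (d.e i)) = tmulH (d.h j i) f := by
  classical
  rw [nuKet, ContinuousLinearMap.comp_apply, d.apply_ν]
  simp [tensorB_tmulH, tensorKet_apply, slice_tmulH, orthonormal_iff_ite.mp d.e.orthonormal]

theorem adjoint_nuKet_tmulH (d : EigenData K Y ν ι) (f g : L2R) (x : 𝒦) (y : 𝔥) :
    (nuKet ν f).adjoint (tmulH x (tmulH y g)) = ⟪f, g⟫_ℂ • ν.adjoint (tmulH x y) := by
  rw [eq_iff_inner_left d.e]
  intro p
  rw [inner_smul_right, ContinuousLinearMap.adjoint_inner_right,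
    ContinuousLinearMap.adjoint_inner_right, nuKet, ContinuousLinearMap.comp_apply, d.apply_ν,
    map_sum, sum_inner, sum_inner, Finset.mul_sum]
  refine Finset.sum_congr rfl fun j _ => ?_
  rw [tensorB_tmulH, inner_tmulH, tensorKet_apply, inner_tmulH, inner_tmulH]
  change ⟪d.e j, x⟫_ℂ * _ = _
  ring

theorem mem_graph_noiseEnergy (d : EigenData K Y ν ι) (hY : IsSelfAdjoint Y) (f : L2R) (j i : ι) :
    (tmulH (d.h j i) f, ((d.κ i - d.κ j : ℝ) : ℂ) • tmulH (d.h j i) f) ∈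
      (tensorOp Y (ofB (ContinuousLinearMap.id ℂ L2R))).graph := by
  have h := mem_graph_tensorOp (adjPair_of_isSelfAdjoint hY) (adjPair_ofB_id L2R)
    (d.mem_graph j i) (mem_graph_ofB.mpr (rfl : ContinuousLinearMap.id ℂ L2R f = f))
  rwa [smul_tmulH] at h

variable [FiniteDimensional ℂ 𝒦]

theorem hasExpectation_sigma_mul (d : EigenData K Y ν ι) (hK : IsSelfAdjoint K)
    (hY : IsSelfAdjoint Y) (β : ℝ) (f₁ f₂ : L2R) (D₁ D₁' D₂ D₂' : 𝒦 →L[ℂ] 𝒦) (t : ℂ) {c : ℂ} :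
    HasExpectation β K
      (opMul (sigma (totalEnergy K Y) t (noiseField ν f₁ D₁ D₁')) (noiseField ν f₂ D₂ D₂')) c ↔
    c = ⟪f₁, f₂⟫_ℂ * d.corr (-(Complex.I * t))
      (D₂' * (gibbs β K * (NormedSpace.exp ((Complex.I * t) • K) * D₁)))
      (D₁' * (NormedSpace.exp (-(Complex.I * t) • K) * D₂)) / tr (gibbs β K) := by
  have h := fun m => mem_graph_sigma_mul (V₁ := nuKet ν f₁) (V₂ := nuKet ν f₂)
    (w₁ := fun j i => tmulH (d.h j i) f₁) (w₂ := fun j i => tmulH (d.h j i) f₂)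
    (c := fun j i => ((d.κ i - d.κ j : ℝ) : ℂ)) d.e hK d.apply_e (adjPair_noiseEnergy hY)
    (d.slice_nuKet f₁) (d.slice_nuKet f₂) (d.mem_graph_noiseEnergy hY f₁)
    (d.mem_graph_noiseEnergy hY f₂) D₁ D₁' D₂ D₂' t m
  refine (d.hasExpectation_iff β h).trans ?_
  simp only [d.adjoint_nuKet_tmulH]
  rw [← d.sum_gibbs_eq_corr β _ _ D₂' (NormedSpace.exp ((Complex.I * t) • K) * D₁) _ _
    fun v => rfl]
  rfl

theorem hasExpectation_mul_sigma (d : EigenData K Y ν ι) (hK : IsSelfAdjoint K)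
    (hY : IsSelfAdjoint Y) (β : ℝ) (f₁ f₂ : L2R) (D₁ D₁' D₂ D₂' : 𝒦 →L[ℂ] 𝒦) (t : ℂ) {c : ℂ} :
    HasExpectation β K
      (opMul (noiseField ν f₂ D₂ D₂') (sigma (totalEnergy K Y) t (noiseField ν f₁ D₁ D₁'))) c ↔
    c = ⟪f₂, f₁⟫_ℂ * d.corr (Complex.I * t)
      (D₁' * (NormedSpace.exp (-(Complex.I * t) • K) * (gibbs β K * D₂)))
      (D₂' * (NormedSpace.exp ((Complex.I * t) • K) * D₁)) / tr (gibbs β K) := by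
  have h := fun m => mem_graph_mul_sigma (V₁ := nuKet ν f₁) (V₂ := nuKet ν f₂)
    (w₁ := fun j i => tmulH (d.h j i) f₁) (w₂ := fun j i => tmulH (d.h j i) f₂)
    (c := fun j i => ((d.κ i - d.κ j : ℝ) : ℂ)) d.e hK d.apply_e (adjPair_noiseEnergy hY)
    (d.slice_nuKet f₁) (d.slice_nuKet f₂) (d.mem_graph_noiseEnergy hY f₁) D₁ D₁' D₂ D₂' t m
  refine (d.hasExpectation_iff β h).trans ?_
  simp only [d.adjoint_nuKet_tmulH]
  rw [← d.sum_gibbs_eq_corr β _ _ (D₁' * NormedSpace.exp (-(Complex.I * t) • K)) D₂ _ _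
    fun v => rfl]
  rfl

/-- At time `t + iβ` the factor `e^{βK}` cancels the Gibbs operator in one slot and `e^{-βK}`
appears in the other. The same two operators thus occur on both sides, in exchanged roles. -/
theorem kms_iff (d : EigenData K Y ν ι) (hK : IsSelfAdjoint K) (hY : IsSelfAdjoint Y) (β : ℝ)
    (f₁ f₂ : L2R) : KMS β K Y ν f₁ f₂ ↔ ∀ (D₁ D₁' D₂ D₂' : 𝒦 →L[ℂ] 𝒦) (t : ℝ),
      ⟪f₁, f₂⟫_ℂ * d.corr (-(Complex.I * t))
        (D₂' * (gibbs β K * (NormedSpace.exp ((Complex.I * t) • K) * D₁)))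
        (D₁' * (NormedSpace.exp (-(Complex.I * t) • K) * D₂)) / tr (gibbs β K) =
      ⟪f₂, f₁⟫_ℂ * d.corr (Complex.I * t - β)
        (D₁' * (NormedSpace.exp (-(Complex.I * t) • K) * D₂))
        (D₂' * (gibbs β K * (NormedSpace.exp ((Complex.I * t) • K) * D₁))) /
          tr (gibbs β K) := by
  refine forall_congr' fun D₁ => forall_congr' fun D₁' => forall_congr' fun D₂ =>
    forall_congr' fun D₂' => forall_congr' fun t => ?_
  have hs : Complex.I * ((t : ℂ) + Complex.I * β) = Complex.I * t - β := by
    linear_combination (β : ℂ) * Complex.I_mul_I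
  have h1 : NormedSpace.exp (-(Complex.I * t - β : ℂ) • K) * (gibbs β K * D₂) =
      NormedSpace.exp (-(Complex.I * t) • K) * D₂ := by
    ext v
    refine (exp_smul_exp_smul K _ _ _).trans ?_
    rw [show -(Complex.I * t - β : ℂ) + -(β : ℂ) = -(Complex.I * t) by ring]
    rfl
  have h2 : NormedSpace.exp ((Complex.I * t - β : ℂ) • K) * D₁ =
      gibbs β K * (NormedSpace.exp ((Complex.I * t) • K) * D₁) := by
    ext v
    refine Eq.trans ?_ (exp_smul_exp_smul K _ _ _).symm
    rw [show (Complex.I * t - β : ℂ) = -(β : ℂ) + Complex.I * t by ring]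
    rfl
  simp only [d.hasExpectation_sigma_mul hK hY, d.hasExpectation_mul_sigma hK hY, hs, h1, h2]
  exact ⟨fun ⟨c, hc, hc'⟩ => hc.symm.trans hc', fun h => ⟨_, rfl, h⟩⟩

theorem corr_ketBra (d : EigenData K Y ν ι) (z : ℂ) (i j s r : ι) :
    d.corr z (ketBra (d.e i) (d.e s)) (ketBra (d.e r) (d.e j)) =
      Complex.exp (z * (d.κ i - d.κ j : ℝ)) * ⟪d.h r s, d.h j i⟫_ℂ := by
  classical
  simp only [corr, ketBra_apply, inner_smul_right, orthonormal_iff_ite.mp d.e.orthonormal,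
    mul_ite, mul_one, mul_zero, Finset.sum_ite_eq, Finset.sum_ite_eq',
    Finset.mem_univ, if_true, Finset.sum_const_zero, Finset.sum_ite_irrel]

/-- The terms match after the order of summation is reversed. Balance supplies `e^{-β(κ r - κ s)}`;
the `z`-exponentials agree because the inner product vanishes unless `κ j - κ i = κ r - κ s`. -/
theorem corr_comm (d : EigenData K Y ν ι) (hY : IsSelfAdjoint Y) {β : ℝ} (hd : d.Balanced β)
    (z : ℂ) (P Q : 𝒦 →L[ℂ] 𝒦) : d.corr (-z) P Q = d.corr (z - β) Q P := by
  rw [corr, corr, sum_four_reverse]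
  refine Finset.sum_congr rfl fun r _ => Finset.sum_congr rfl fun s _ =>
    Finset.sum_congr rfl fun j _ => Finset.sum_congr rfl fun i _ => ?_
  have key : Complex.exp (-z * (d.κ i - d.κ j : ℝ)) * ⟪d.h r s, d.h j i⟫_ℂ =
      Complex.exp ((z - β) * (d.κ r - d.κ s : ℝ)) * ⟪d.h i j, d.h s r⟫_ℂ := by
    rw [hd i s j r]
    by_cases h0 : ⟪d.h i j, d.h s r⟫_ℂ = 0
    · rw [h0, mul_zero, mul_zero, mul_zero]
    · have hκ : d.κ j - d.κ i = d.κ r - d.κ s := by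
        by_contra hne
        exact h0 (d.inner_h_eq_zero hY hne)
      rw [← mul_assoc, ← Complex.exp_add, ← hκ]
      congr 2
      push_cast
      ring
  rw [key]
  ring

theorem kms_of_balanced (d : EigenData K Y ν ι) (hK : IsSelfAdjoint K) (hY : IsSelfAdjoint Y)
    {β : ℝ} (hd : d.Balanced β) {f₁ f₂ : L2R} (hf : (⟪f₁, f₂⟫_ℂ).im = 0) :
    KMS β K Y ν f₁ f₂ := by
  rw [d.kms_iff hK hY]
  intro D₁ D₁' D₂ D₂' t
  rw [d.corr_comm hY hd, ← inner_conj_symm f₂ f₁, Complex.conj_eq_iff_im.mpr hf]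

theorem balanced_of_kms (d : EigenData K Y ν ι) (hK : IsSelfAdjoint K) (hY : IsSelfAdjoint Y)
    {β : ℝ} {f : L2R} (hf : f ≠ 0) (h : KMS β K Y ν f f) : d.Balanced β := by
  intro a b p q
  have : Nonempty ι := ⟨a⟩
  -- At `t = 0` the choice `D₁ = e^{βK}` cancels the Gibbs operator, leaving `P = |e_a)(e_b|` and `Q
  -- = |e_q)(e_p|`.
  have h1 := (d.kms_iff hK hY β f f).mp h (NormedSpace.exp ((β : ℂ) • K)) 1
    (ketBra (d.e q) (d.e p)) (ketBra (d.e a) (d.e b)) 0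
  have h2 : gibbs β K * NormedSpace.exp ((β : ℂ) • K) = 1 := by
    ext v
    refine (exp_smul_exp_smul K _ _ _).trans ?_
    simp
  simp only [Complex.ofReal_zero, mul_zero, neg_zero, zero_smul, NormedSpace.exp_zero, one_mul,
    h2, mul_one, zero_sub, d.corr_ketBra, zero_mul, Complex.exp_zero] at h1
  rw [div_left_inj' (d.tr_gibbs_ne_zero β)] at h1
  exact mul_left_cancel₀ (inner_self_ne_zero.mpr hf) h1

end EigenData

/-! ### Real test functions -/

open MeasureTheory

theorem inner_im_eq_zero_of_real {f g : L2R} (hf : ∀ᵐ x, (f x).im = 0)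
    (hg : ∀ᵐ x, (g x).im = 0) : (⟪f, g⟫_ℂ).im = 0 := by
  have h : ⟪f, g⟫_ℂ = ((∫ x, (f x).re * (g x).re : ℝ) : ℂ) := by
    rw [L2.inner_def]
    refine Eq.trans ?_ (integral_ofReal (𝕜 := ℂ))
    refine integral_congr_ae ?_
    filter_upwards [hf, hg] with x hx hy
    have h1 : ((f x).re : ℂ) = f x := Complex.ext rfl (by simp [hx])
    have h2 : ((g x).re : ℂ) = g x := Complex.ext rfl (by simp [hy])
    rw [← h1, ← h2]
    simp [mul_comm]
  rw [h, Complex.ofReal_im]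

theorem exists_real_L2R : ∃ f : L2R, f ≠ 0 ∧ ∀ᵐ x, (f x).im = 0 := by
  have hμ : (volume (Set.Icc (0 : ℝ) 1)) ≠ ⊤ := by simp
  refine ⟨indicatorConstLp 2 measurableSet_Icc hμ (1 : ℂ), ?_, ?_⟩
  · rw [← norm_ne_zero_iff, norm_indicatorConstLp (by simp) (by simp)]
    simp
  · filter_upwards [indicatorConstLp_coeFn (p := 2) (hs := measurableSet_Icc) (hμs := hμ)
      (c := (1 : ℂ))] with x hx
    rw [hx]
    by_cases h : x ∈ Set.Icc (0 : ℝ) 1 <;> simp [h]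

end KMS

end QuantumNoise
namespace QuantumNoise


/-! ### Detailed balance -/

section DetailedBalance

variable {𝒦 𝔥 : Type*} [NormedAddCommGroup 𝒦] [InnerProductSpace ℂ 𝒦] [CompleteSpace 𝒦]
  [NormedAddCommGroup 𝔥] [InnerProductSpace ℂ 𝔥] [CompleteSpace 𝔥]

/-- An orthonormal basis of the span of the `g i` suffices. It is finite even if `𝔥` is not, which
is what leaves only finitely many `Lⱼ`. -/
theorem exists_parseval_family {ι : Type*} [Finite ι] (g : ι → 𝔥) :
    ∃ (n : ℕ) (b : Fin n → 𝔥), ∀ i i', ∑ j, ⟪g i, b j⟫_ℂ * ⟪b j, g i'⟫_ℂ = ⟪g i, g i'⟫_ℂ := by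
  let S := Submodule.span ℂ (Set.range g)
  have : FiniteDimensional ℂ S := FiniteDimensional.span_of_finite ℂ (Set.finite_range g)
  let b := stdOrthonormalBasis ℂ S
  refine ⟨_, fun j => (b j : 𝔥), fun i i' => ?_⟩
  exact b.sum_inner_mul_inner ⟨g i, Submodule.subset_span ⟨i, rfl⟩⟩
    ⟨g i', Submodule.subset_span ⟨i', rfl⟩⟩

theorem tr_mul_comm (A B : 𝒦 →L[ℂ] 𝒦) : tr (A * B) = tr (B * A) :=
  LinearMap.trace_mul_comm ℂ _ _

theorem rhoInner_mul_left {ρ X : 𝒦 →L[ℂ] 𝒦} (hX : IsSelfAdjoint X)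
    (h : Commute (CFC.sqrt ρ) X) (A B : 𝒦 →L[ℂ] 𝒦) :
    rhoInner ρ (X * A) B = rhoInner ρ A (X * B) := by
  rw [rhoInner, rhoInner, star_mul, hX.star_eq]
  congr 1
  simp only [mul_assoc]
  rw [← mul_assoc X, ← h.eq, mul_assoc]

theorem rhoInner_mul_right {ρ X : 𝒦 →L[ℂ] 𝒦} (hX : IsSelfAdjoint X)
    (h : Commute (CFC.sqrt ρ) X) (A B : 𝒦 →L[ℂ] 𝒦) :
    rhoInner ρ (A * X) B = rhoInner ρ A (B * X) := by
  rw [rhoInner, rhoInner, star_mul, hX.star_eq, ← mul_assoc, ← mul_assoc, h.eq, tr_mul_comm _ X]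
  simp only [mul_assoc]

theorem tr_add (A B : 𝒦 →L[ℂ] 𝒦) : tr (A + B) = tr A + tr B := map_add _ _ _

theorem tr_smul (c : ℂ) (A : 𝒦 →L[ℂ] 𝒦) : tr (c • A) = c * tr A := map_smul _ _ _

theorem rhoInner_add_left (ρ A A' B : 𝒦 →L[ℂ] 𝒦) :
    rhoInner ρ (A + A') B = rhoInner ρ A B + rhoInner ρ A' B := by
  simp only [rhoInner, star_add, mul_add, add_mul, tr_add]

theorem rhoInner_add_right (ρ A B B' : 𝒦 →L[ℂ] 𝒦) :
    rhoInner ρ A (B + B') = rhoInner ρ A B + rhoInner ρ A B' := by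
  simp only [rhoInner, mul_add, tr_add]

theorem rhoInner_smul_left (ρ : 𝒦 →L[ℂ] 𝒦) (c : ℂ) (A B : 𝒦 →L[ℂ] 𝒦) :
    rhoInner ρ (c • A) B = star c * rhoInner ρ A B := by
  simp only [rhoInner, star_smul, mul_smul_comm, smul_mul_assoc, tr_smul]

theorem rhoInner_smul_right (ρ : 𝒦 →L[ℂ] 𝒦) (c : ℂ) (A B : 𝒦 →L[ℂ] 𝒦) :
    rhoInner ρ A (c • B) = c * rhoInner ρ A B := by
  simp only [rhoInner, mul_smul_comm, tr_smul]

theorem isSelfAdjoint_adjoint_comp_self (ν : 𝒦 →L[ℂ] HTensor 𝒦 𝔥) :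
    IsSelfAdjoint (ν.adjoint ∘L ν) :=
  ContinuousLinearMap.IsPositive.isSelfAdjoint (ContinuousLinearMap.isPositive_adjoint_comp_self ν)

variable {ι : Type*} [Fintype ι] {K : 𝒦 →L[ℂ] 𝒦} {Y : 𝔥 →ₗ.[ℂ] 𝔥} {ν : 𝒦 →L[ℂ] HTensor 𝒦 𝔥}

theorem eq_of_inner_basis (e : OrthonormalBasis ι ℂ 𝒦) {S T : 𝒦 →L[ℂ] 𝒦}
    (h : ∀ p q, ⟪e p, S (e q)⟫_ℂ = ⟪e p, T (e q)⟫_ℂ) : S = T :=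
  clm_ext_inner e fun q => (eq_iff_inner_left e).mpr fun p => h p q

theorem isSelfAdjoint_of_inner_basis (e : OrthonormalBasis ι ℂ 𝒦) {T : 𝒦 →L[ℂ] 𝒦}
    (h : ∀ p q, ⟪T (e p), e q⟫_ℂ = ⟪e p, T (e q)⟫_ℂ) : IsSelfAdjoint T := by
  refine eq_of_inner_basis e fun p q => ?_
  rw [ContinuousLinearMap.star_eq_adjoint, ContinuousLinearMap.adjoint_inner_right, h]

theorem inner_apply_eq_sum (e : OrthonormalBasis ι ℂ 𝒦) (T : 𝒦 →L[ℂ] 𝒦) (x y : 𝒦) :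
    ⟪x, T y⟫_ℂ = ∑ k, ∑ l, ⟪x, e k⟫_ℂ * ⟪e l, y⟫_ℂ * ⟪e k, T (e l)⟫_ℂ := by
  rw [← e.sum_inner_mul_inner x (T y)]
  refine Finset.sum_congr rfl fun k _ => ?_
  conv_lhs => rw [← e.sum_repr' y]
  simp only [map_sum, map_smul, inner_sum, inner_smul_right, Finset.mul_sum, mul_assoc]

namespace EigenData

theorem apply_gibbs (d : EigenData K Y ν ι) (β : ℝ) (p : ι) :
    gibbs β K (d.e p) = Complex.exp (-(β : ℂ) * d.κ p) • d.e p :=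
  exp_apply_eigen (d.apply_e p) _

/-- The diagonal operator with these eigenvalues is positive and squares to `ρ`, so uniqueness of
the positive root applies. The normalization `s` is a common factor and stays anonymous. -/
theorem sqrt_gibbsState (d : EigenData K Y ν ι) (β : ℝ) : ∃ s : ℝ, ∀ p,
    CFC.sqrt (gibbsState β K) (d.e p) = ((s * Real.exp (-β * d.κ p / 2) : ℝ) : ℂ) • d.e p := by
  classical
  set Z : ℝ := ∑ m, Real.exp (-β * d.κ m)
  have hZ : 0 ≤ Z⁻¹ := inv_nonneg.mpr (Finset.sum_nonneg fun m _ => (Real.exp_pos _).le)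
  refine ⟨√Z⁻¹, ?_⟩
  set w : ι → ℝ := fun p => √Z⁻¹ * Real.exp (-β * d.κ p / 2)
  have hw : ∀ p, 0 ≤ w p := fun p => by positivity
  set R : 𝒦 →L[ℂ] 𝒦 := ∑ p, ((w p : ℝ) : ℂ) • ketBra (d.e p) (d.e p) with hR
  have hRe : ∀ p, R (d.e p) = (w p : ℂ) • d.e p := fun p => by
    simp [hR, sum_apply, smul_apply, ketBra_apply, orthonormal_iff_ite.mp d.e.orthonormal]
  have h0 : 0 ≤ R := by
    refine Finset.sum_nonneg fun p _ => ?_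
    rw [Complex.coe_smul]
    exact smul_nonneg (hw p) ((ContinuousLinearMap.nonneg_iff_isPositive _).mpr
      (InnerProductSpace.isPositive_rankOne_self (d.e p)))
  have h1 : R * R = gibbsState β K := by
    refine clm_ext_inner d.e fun p => ?_
    change R (R (d.e p)) = (tr (gibbs β K))⁻¹ • gibbs β K (d.e p)
    rw [hRe, map_smul, hRe, d.apply_gibbs, smul_smul, smul_smul, d.tr_gibbs]
    congr 1
    have : w p * w p = Z⁻¹ * Real.exp (-β * d.κ p) := by
      rw [mul_mul_mul_comm, Real.mul_self_sqrt hZ, ← Real.exp_add]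
      ring_nf
    rw [← Complex.ofReal_mul, this]
    push_cast [Z]
    rfl
  rw [CFC.sqrt_unique h1 h0]
  exact hRe

theorem rhoInner_gibbsState (d : EigenData K Y ν ι) (β : ℝ) : ∃ s : ℂ, ∀ A B,
    rhoInner (gibbsState β K) A B = s * ∑ p, ∑ q, Complex.exp (-β * (d.κ p + d.κ q) / 2) *
      (⟪A (d.e p), d.e q⟫_ℂ * ⟪d.e q, B (d.e p)⟫_ℂ) := by
  obtain ⟨s, hs⟩ := d.sqrt_gibbsState β
  have hR : IsSelfAdjoint (CFC.sqrt (gibbsState β K)) := (CFC.sqrt_nonneg _).isSelfAdjoint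
  refine ⟨s ^ 2, fun A B => ?_⟩
  rw [rhoInner, tr_eq_sum_inner d.e, Finset.mul_sum]
  refine Finset.sum_congr rfl fun p _ => ?_
  change ⟪d.e p, CFC.sqrt (gibbsState β K) (star A (CFC.sqrt (gibbsState β K) (B (d.e p))))⟫_ℂ = _
  rw [← hR.adjoint_eq, ContinuousLinearMap.adjoint_inner_right, hs,
    ContinuousLinearMap.star_eq_adjoint, ContinuousLinearMap.adjoint_inner_right, map_smul,
    ← d.e.sum_inner_mul_inner, Finset.mul_sum]
  refine Finset.sum_congr rfl fun q _ => ?_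
  rw [ContinuousLinearMap.adjoint_inner_right, hs, inner_smul_left, inner_smul_left,
    Complex.conj_ofReal, Complex.conj_ofReal]
  have : Complex.exp (-β * (d.κ p + d.κ q) / 2) =
      Complex.exp (-β * d.κ p / 2) * Complex.exp (-β * d.κ q / 2) := by
    rw [← Complex.exp_add]
    ring_nf
  rw [this]
  push_cast
  ring

theorem inner_adjoint_tensorB (d : EigenData K Y ν ι) (A : 𝒦 →L[ℂ] 𝒦) (p q : ι) :
    ⟪d.e p, (ν.adjoint ∘L tensorB A (ContinuousLinearMap.id ℂ 𝔥) ∘L ν) (d.e q)⟫_ℂ =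
      ∑ j, ∑ l, ⟪d.e j, A (d.e l)⟫_ℂ * ⟪d.h j p, d.h l q⟫_ℂ := by
  rw [ContinuousLinearMap.comp_apply, ContinuousLinearMap.comp_apply, d.apply_ν, map_sum, map_sum,
    inner_sum, Finset.sum_comm]
  refine Finset.sum_congr rfl fun l _ => ?_
  rw [tensorB_tmulH, d.inner_adjoint_ν_tmulH]
  rfl

theorem inner_adjoint_comp_self (d : EigenData K Y ν ι) (p q : ι) :
    ⟪d.e p, (ν.adjoint ∘L ν) (d.e q)⟫_ℂ = ∑ j, ⟪d.h j p, d.h j q⟫_ℂ := by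
  classical
  rw [ContinuousLinearMap.comp_apply, d.apply_ν, map_sum, inner_sum]
  refine Finset.sum_congr rfl fun l _ => ?_
  simp [d.inner_adjoint_ν_tmulH, orthonormal_iff_ite.mp d.e.orthonormal]

/-- The entry of `ν*ν` at `(p, q)` is `∑ⱼ ⟪h j p, h j q⟫`, which vanishes unless `κ p = κ q`. -/
theorem commute_adjoint_comp_self (d : EigenData K Y ν ι) (hK : IsSelfAdjoint K)
    (hY : IsSelfAdjoint Y) : Commute (ν.adjoint ∘L ν) K := by
  refine eq_of_inner_basis d.e fun p q => ?_
  change ⟪d.e p, (ν.adjoint ∘L ν) (K (d.e q))⟫_ℂ = ⟪d.e p, K ((ν.adjoint ∘L ν) (d.e q))⟫_ℂ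
  have hs := ContinuousLinearMap.isSelfAdjoint_iff_isSymmetric.mp hK
  refine Eq.trans ?_ (hs (d.e p) ((ν.adjoint ∘L ν) (d.e q)))
  rw [ContinuousLinearMap.coe_coe, d.apply_e, d.apply_e, map_smul, inner_smul_right,
    inner_smul_left, Complex.conj_ofReal]
  by_cases h : d.κ p = d.κ q
  · rw [h]
  · rw [d.inner_adjoint_comp_self, Finset.sum_eq_zero fun j _ => d.inner_h_eq_zero hY
      (fun h' => h (by linarith)), mul_zero, mul_zero]

/-- The weights `ρ^{1/2}` put balance in the symmetric form `h2`. Where the inner product is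
nonzero, `κ p - κ l = κ q - κ j`, and this turns the one-sided factor `e^{-β(κ q - κ j)}` into the
ratio of the two weights. -/
theorem rhoInner_adjoint_tensorB (d : EigenData K Y ν ι) (hY : IsSelfAdjoint Y) {β : ℝ}
    (hd : d.Balanced β) (A B : 𝒦 →L[ℂ] 𝒦) :
    rhoInner (gibbsState β K) (ν.adjoint ∘L tensorB A (ContinuousLinearMap.id ℂ 𝔥) ∘L ν) B =
    rhoInner (gibbsState β K) A (ν.adjoint ∘L tensorB B (ContinuousLinearMap.id ℂ 𝔥) ∘L ν) := by
  obtain ⟨s, hs⟩ := d.rhoInner_gibbsState β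
  rw [hs, hs]
  congr 1
  have h1 : ∀ p q, ⟪(ν.adjoint ∘L tensorB A (ContinuousLinearMap.id ℂ 𝔥) ∘L ν) (d.e p), d.e q⟫_ℂ =
      ∑ j, ∑ l, ⟪A (d.e l), d.e j⟫_ℂ * ⟪d.h l p, d.h j q⟫_ℂ := by
    intro p q
    rw [← inner_conj_symm, d.inner_adjoint_tensorB]
    simp only [map_sum, map_mul, inner_conj_symm]
  simp only [h1, d.inner_adjoint_tensorB, Finset.mul_sum, Finset.sum_mul]
  have h2 : ∀ p q j l,
      Complex.exp (-β * (d.κ p + d.κ q) / 2) * ⟪d.h l p, d.h j q⟫_ℂ =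
      Complex.exp (-β * (d.κ l + d.κ j) / 2) * ⟪d.h q j, d.h p l⟫_ℂ := by
    intro p q j l
    rw [hd l j p q]
    by_cases h0 : ⟪d.h l p, d.h j q⟫_ℂ = 0
    · rw [h0, mul_zero, mul_zero, mul_zero]
    · have hκ : d.κ p - d.κ l = d.κ q - d.κ j := by
        by_contra hne
        exact h0 (d.inner_h_eq_zero hY hne)
      rw [← mul_assoc, ← Complex.exp_add, ← hκ]
      have : (d.κ q : ℂ) = d.κ p - d.κ l + d.κ j := by
        rw [← Complex.ofReal_sub, hκ]
        push_cast
        ring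
      rw [this]
      congr 2
      push_cast
      ring
  have h3 := sum_four_reverse fun p q j l =>
    Complex.exp (-β * (d.κ p + d.κ q) / 2) *
      (⟪A (d.e l), d.e j⟫_ℂ * ⟪d.h l p, d.h j q⟫_ℂ * ⟪d.e q, B (d.e p)⟫_ℂ)
  refine h3.trans (Finset.sum_congr rfl fun l _ => Finset.sum_congr rfl fun j _ =>
    Finset.sum_congr rfl fun q _ => Finset.sum_congr rfl fun p _ => ?_)
  linear_combination (⟪A (d.e l), d.e j⟫_ℂ * ⟪d.e q, B (d.e p)⟫_ℂ) * h2 p q j l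

theorem inner_adjoint_tensorKet_comp_ν (d : EigenData K Y ν ι) (b : 𝔥) (k i : ι) :
    ⟪d.e k, ((tensorKet 𝒦 b).adjoint ∘L ν) (d.e i)⟫_ℂ = ⟪b, d.h k i⟫_ℂ := by
  classical
  rw [ContinuousLinearMap.comp_apply, d.apply_ν]
  simp [adjoint_tensorKet_tmulH, orthonormal_iff_ite.mp d.e.orthonormal]

/-- Slicing `ν` gives Kraus operators `Lⱼ` that need not be traceless. Subtracting the scalars `cⱼ`
produces the cross terms `A X` and `X* A` with `X = ∑ⱼ c̄ⱼ Lⱼ`, whose anti-self-adjoint part would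
be a Hamiltonian. Balance makes `X` self-adjoint, so all corrections are absorbed by `Δ`. -/
theorem purelyDissipative (d : EigenData K Y ν ι) {β : ℝ} (hd : d.Balanced β) :
    PurelyDissipative fun A : 𝒦 →L[ℂ] 𝒦 =>
      -((1 / 2 : ℂ) • (ν.adjoint ∘L ν) * A + A * (1 / 2 : ℂ) • (ν.adjoint ∘L ν)) +
        ν.adjoint ∘L tensorB A (ContinuousLinearMap.id ℂ 𝔥) ∘L ν := by
  obtain ⟨n, b, hb⟩ := exists_parseval_family fun x : ι × ι => d.h x.1 x.2
  have hb' : ∀ k p l q, ∑ j, ⟪d.h k p, b j⟫_ℂ * ⟪b j, d.h l q⟫_ℂ = ⟪d.h k p, d.h l q⟫_ℂ :=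
    fun k p l q => hb (k, p) (l, q)
  set L : Fin n → 𝒦 →L[ℂ] 𝒦 := fun j => (tensorKet 𝒦 (b j)).adjoint ∘L ν
  have hL : ∀ j p q, ⟪d.e p, L j (d.e q)⟫_ℂ = ⟪b j, d.h p q⟫_ℂ :=
    fun j => d.inner_adjoint_tensorKet_comp_ν (b j)
  have hL' : ∀ j p q, ⟪L j (d.e p), d.e q⟫_ℂ = ⟪d.h q p, b j⟫_ℂ := fun j p q => by
    rw [← inner_conj_symm, hL, inner_conj_symm]
  have hΦ : ∀ A, ν.adjoint ∘L tensorB A (ContinuousLinearMap.id ℂ 𝔥) ∘L ν =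
      ∑ j, star (L j) * A * L j := by
    intro A
    refine eq_of_inner_basis d.e fun p q => ?_
    rw [d.inner_adjoint_tensorB, sum_apply, inner_sum]
    have h1 : ∀ j, ⟪d.e p, (star (L j) * A * L j) (d.e q)⟫_ℂ =
        ∑ k, ∑ l, ⟪d.h k p, b j⟫_ℂ * ⟪b j, d.h l q⟫_ℂ * ⟪d.e k, A (d.e l)⟫_ℂ := by
      intro j
      change ⟪d.e p, star (L j) (A (L j (d.e q)))⟫_ℂ = _
      rw [ContinuousLinearMap.star_eq_adjoint, ContinuousLinearMap.adjoint_inner_right,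
        inner_apply_eq_sum d.e]
      simp only [hL, hL']
    simp only [h1, ← hb', Finset.mul_sum]
    rw [eq_comm, Finset.sum_comm]
    refine Finset.sum_congr rfl fun k _ => ?_
    rw [Finset.sum_comm]
    exact Finset.sum_congr rfl fun l _ => Finset.sum_congr rfl fun j _ => mul_comm _ _
  have htr : ∀ j, tr (L j) = ∑ m, ⟪b j, d.h m m⟫_ℂ := fun j => by
    rw [tr_eq_sum_inner d.e]
    simp only [hL]
  have htr1 : tr (1 : 𝒦 →L[ℂ] 𝒦) = Fintype.card ι := by
    rw [tr_eq_sum_inner d.e]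
    simp [inner_self_eq_norm_sq_to_K]
  set c : Fin n → ℂ := fun j => tr (L j) / Fintype.card ι
  have htr0 : ∀ j, tr (L j + (-c j) • 1) = 0 := fun j => by
    rw [tr_add, tr_smul, htr1]
    -- In dimension zero the trace of `L j` and the cardinality both vanish.
    obtain h | h := isEmpty_or_nonempty ι
    · simp [htr]
    · have : (Fintype.card ι : ℂ) ≠ 0 := by exact_mod_cast Fintype.card_ne_zero
      simp only [c]
      field_simp
      ring
  set X : 𝒦 →L[ℂ] 𝒦 := ∑ j, star (c j) • L j
  have hX : IsSelfAdjoint X := by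
    have h1 : ∀ p q, ⟪d.e p, X (d.e q)⟫_ℂ =
        (Fintype.card ι : ℂ)⁻¹ * ∑ m, ⟪d.h m m, d.h p q⟫_ℂ := by
      intro p q
      simp only [X, sum_apply, smul_apply, inner_sum, inner_smul_right, hL, c, htr, star_div₀,
        ← hb', Finset.sum_div, Finset.mul_sum, Finset.sum_mul, star_sum]
      rw [Finset.sum_comm]
      refine Finset.sum_congr rfl fun m _ => Finset.sum_congr rfl fun j _ => ?_
      rw [← inner_conj_symm (d.h m m) (b j)]
      simp
      ring
    refine isSelfAdjoint_of_inner_basis d.e fun p q => ?_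
    rw [← inner_conj_symm, h1, h1, map_mul, map_inv₀, map_natCast, map_sum]
    congr 1
    refine Finset.sum_congr rfl fun m _ => ?_
    -- Here the Boltzmann factor is `e^{-β(κ m - κ m)} = 1`, so balance is plain symmetry of the
    -- entries.
    rw [inner_conj_symm, hd q m p m]
    simp
  set γ : ℝ := ∑ j, ‖c j‖ ^ 2
  have hγ : ∑ j, star (c j) * c j = (γ : ℂ) := by
    simp only [γ]
    push_cast
    exact Finset.sum_congr rfl fun j _ => Complex.conj_mul' (c j)
  refine ⟨n, (1 / 2 : ℂ) • (ν.adjoint ∘L ν) - X + ((γ / 2 : ℝ) : ℂ) • 1,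
    fun j => L j + (-c j) • 1, ?_, htr0, fun A => ?_⟩
  · refine ((IsSelfAdjoint.smul ?_ (isSelfAdjoint_adjoint_comp_self ν)).sub hX).add
      (IsSelfAdjoint.smul (Complex.conj_ofReal _) (IsSelfAdjoint.one _))
    simp [IsSelfAdjoint]
  · have h1 : ∀ j, star (L j + (-c j) • 1) * A * (L j + (-c j) • 1) =
        star (L j) * A * L j - A * (star (c j) • L j) - star (star (c j) • L j) * A +
          (star (c j) * c j) • A := by
      intro j
      simp only [star_add, star_smul, star_one, star_neg, star_star, neg_smul, add_mul, mul_add,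
        smul_mul_assoc, mul_smul_comm, mul_one, one_mul, neg_mul, mul_neg]
      module
    have h2 : ∑ j, star (L j + (-c j) • 1) * A * (L j + (-c j) • 1) =
        (∑ j, star (L j) * A * L j) - A * X - X * A + (γ : ℂ) • A := by
      rw [← hγ, Finset.sum_smul]
      nth_rewrite 2 [← hX.star_eq]
      rw [star_sum, Finset.mul_sum, Finset.sum_mul, ← Finset.sum_sub_distrib,
        ← Finset.sum_sub_distrib, ← Finset.sum_add_distrib]
      exact Finset.sum_congr rfl fun j _ => h1 j
    simp only [h2, hΦ]
    have h3 : (γ : ℂ) • A = ((γ / 2 : ℝ) : ℂ) • A + ((γ / 2 : ℝ) : ℂ) • A := by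
      rw [← add_smul]
      congr 1
      push_cast
      ring
    rw [h3]
    simp only [add_mul, sub_mul, mul_add, mul_sub, smul_mul_assoc, mul_smul_comm, one_mul, mul_one]
    abel

theorem detailedBalance (d : EigenData K Y ν ι) (hK : IsSelfAdjoint K) (hY : IsSelfAdjoint Y)
    {β : ℝ} (hd : d.Balanced β) {Υ : 𝒦 →L[ℂ] 𝒦}
    (hΥ : -Complex.I • Υ + Complex.I • star Υ = -(ν.adjoint ∘L ν))
    (hc : Commute ((1 / 2 : ℂ) • (Υ + star Υ)) K) :
    DetailedBalance (lindblad Υ ν) (gibbsState β K) := by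
  set N := ν.adjoint ∘L ν
  set Θ : 𝒦 →L[ℂ] 𝒦 := (1 / 2 : ℂ) • (Υ + star Υ)
  have hΘ : IsSelfAdjoint Θ :=
    IsSelfAdjoint.smul (by simp [IsSelfAdjoint]) (IsSelfAdjoint.add_star_self Υ)
  have hsqrt : ∀ T : 𝒦 →L[ℂ] 𝒦, Commute T K → Commute (CFC.sqrt (gibbsState β K)) T := by
    intro T hT
    have h1 : Commute (gibbsState β K) T :=
      (((hT.smul_right (-(β : ℂ))).exp_right).smul_right _).symm
    exact h1.cfcₙ_nnreal _
  have hN2 : IsSelfAdjoint ((1 / 2 : ℂ) • (ν.adjoint ∘L ν)) :=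
    IsSelfAdjoint.smul (by simp [IsSelfAdjoint]) (isSelfAdjoint_adjoint_comp_self ν)
  have hNc := hsqrt _ ((d.commute_adjoint_comp_self hK hY).smul_left (1 / 2 : ℂ))
  have hΥN : N = Complex.I • Υ - Complex.I • star Υ := by
    rw [← neg_eq_iff_eq_neg.mpr hΥ]
    module
  have hI : Complex.I ^ 2 = -1 := Complex.I_sq
  have hΥ1 : Υ = Θ - (Complex.I / 2) • N := by
    rw [hΥN]
    simp only [Θ]
    match_scalars <;> ring_nf <;> rw [hI] <;> norm_num
  have hΥ2 : star Υ = Θ + (Complex.I / 2) • N := by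
    rw [hΥN]
    simp only [Θ]
    match_scalars <;> ring_nf <;> rw [hI] <;> norm_num
  -- The sign comes from `-i(Υ A - A Υ*) = -i[Θ, A] - ½(N A + A N)`.
  refine ⟨-Θ, _, hΘ.neg, d.purelyDissipative hd, fun A => ?_, fun A B => ?_, fun A B => ?_⟩
  · rw [lindblad, ← add_assoc]
    congr 1
    rw [hΥ2]
    nth_rewrite 1 [hΥ1]
    simp only [sub_mul, mul_add, neg_mul, mul_neg, smul_mul_assoc, mul_smul_comm]
    match_scalars <;> ring_nf <;> (try rw [hI]) <;> norm_num
  · rw [← neg_one_smul ℂ, ← neg_one_smul ℂ (_ * B + _)]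
    simp only [rhoInner_add_left, rhoInner_add_right, rhoInner_smul_left, rhoInner_smul_right,
      rhoInner_mul_left hN2 hNc, rhoInner_mul_right hN2 hNc, d.rhoInner_adjoint_tensorB hY hd,
      star_neg, star_one]
  · have hc' := (hsqrt _ hc).neg_right
    rw [sub_eq_add_neg, sub_eq_add_neg, ← neg_one_smul ℂ (A * _), ← neg_one_smul ℂ (B * _)]
    simp only [rhoInner_add_left, rhoInner_add_right, rhoInner_smul_left, rhoInner_smul_right,
      rhoInner_mul_left hΘ.neg hc', rhoInner_mul_right hΘ.neg hc']
    simp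

end EigenData

end DetailedBalance

end QuantumNoise

/-! ### The main theorem -/

open QuantumNoise in
theorem mainTheorem11 {𝒦 𝔥 : Type*}
    [NormedAddCommGroup 𝒦] [InnerProductSpace ℂ 𝒦] [FiniteDimensional ℂ 𝒦] [CompleteSpace 𝒦]
    [NormedAddCommGroup 𝔥] [InnerProductSpace ℂ 𝔥] [CompleteSpace 𝔥]
    (β : ℝ) (hβ : 0 < β)
    (K : 𝒦 →L[ℂ] 𝒦) (hK : IsSelfAdjoint K)
    (Y : 𝔥 →ₗ.[ℂ] 𝔥) (hY : IsSelfAdjoint Y)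
    (ν : 𝒦 →L[ℂ] HTensor 𝒦 𝔥) (hν : Intertwines K Y ν) :
    [∀ f₁ f₂ : L2R, (∀ᵐ x, (f₁ x).im = 0) → (∀ᵐ x, (f₂ x).im = 0) → KMS β K Y ν f₁ f₂,
      ∀ f₁ f₂ : L2R, (inner ℂ f₁ f₂).im = 0 → KMS β K Y ν f₁ f₂,
      TraceCondition β Y ν].TFAE ∧
    (TraceCondition β Y ν → ∀ Υ : 𝒦 →L[ℂ] 𝒦,
      -Complex.I • Υ + Complex.I • star Υ = -(ν.adjoint ∘L ν) →
      Commute ((1 / 2 : ℂ) • (Υ + star Υ)) K →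
      DetailedBalance (lindblad Υ ν) (gibbsState β K)) := by
  obtain ⟨d⟩ := exists_eigenData hK hY hν
  rw [d.traceCondition_iff hY]
  refine ⟨?_, fun hd Υ hΥ hc => d.detailedBalance hK hY hd hΥ hc⟩
  tfae_have 3 → 2 := fun hd f₁ f₂ hf => d.kms_of_balanced hK hY hd hf
  tfae_have 2 → 1 := fun h f₁ f₂ h₁ h₂ => h f₁ f₂ (inner_im_eq_zero_of_real h₁ h₂)
  tfae_have 1 → 3 := fun h => by
    obtain ⟨f, hf, hr⟩ := exists_real_L2R
    exact d.balanced_of_kms hK hY hf (h f f hr hr)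
  tfae_finish
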